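/- **Setting.** Consider finite directed hypergraphs whose hyperedges are labelled by the generators $\mu:2\to1$, $\eta:0\to1$, $\delta:1\to2$, $\epsilon:1\to0$, a hyperedge labelled $o:k\to l$ having $k$ ordered sources and $l$ ordered targets. An $(n,m)$-hypergraph is a cospan $n\to G\leftarrow m$ of such hypergraphs with discrete feet. It is *monogamous* if both legs are mono, every input has in-degree $0$ and every other node in-degree $1$, and every output has out-degree $0$ and every other node out-degree $1$; it is *acyclic* if there is no directed path (a non-empty sequence of hyperedges, each a successor of the previous one) from a node to itself. Let $\mathsf{BA}$ be the DPOI rewriting system of non-commutative bialgebras, with the ten rules ($\sigma$ denotes the symmetry, "$;$" sequential and "$\oplus$" parallel composition, and each side is read as a hypergraph with interfaces): 1. $(\mu\oplus id);\mu\to(id\oplus\mu);\mu$; 2. $\delta;(\delta\oplus id)\to\delta;(id\oplus\delta)$; 3. $(\eta\oplus id);\mu\to id$; 4. $(id\oplus\eta);\mu\to id$; 5. $\delta;(\epsilon\oplus id)\to id$; 6. $\delta;(id\oplus\epsilon)\to id$; 7. $\eta;\delta\to\eta\oplus\eta$; 8. $\mu;\epsilon\to\epsilon\oplus\epsilon$;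 9. $\mu;\delta\to(\delta\oplus\delta);(id\oplus\sigma\oplus id);(\mu\oplus\mu)$; 10. $\eta;\epsilon\to id_0$. A rewriting step from $D$ to $E$ with interface $n+m$ is a convex DPOI step: for some rule $L\leftarrow i+j\to R$ there is a double pushout $L\to D\leftarrow C$, $C\to E\leftarrow R$ over $L\leftarrow i+j\to R$, with $i+j\xrightarrow{[c_1,c_2]}C$, and a morphism $n+m\xrightarrow{[d_1,d_2]}C$ inducing the interfaces of $D$ and $E$, such that $L\to D$ is mono with convex image (every hyperedge of a path of $D$ between nodes of the image lies in the image), $[c_1,c_2]$ is mono and $j+n\xrightarrow{[c_2,d_1]}C\xleftarrow{[d_2,c_1]}m+i$ is monogamous. **The ordering.** Paths are counted together with the nodes they traverse. A *U-path* is a path from an input node or an $\eta$-hyperedge to an output node or an $\epsilon$-hyperedge, and an *M-path* is a path from a $\mu$-hyperedge to a $\delta$-hyperedge. The *L-weight* is the sum over all $\mu$-hyperedges $h$ of the number of hyperedges in the maximal tree of $\mu$-hyperedges whose root (output) is the first source of $h$, plus the sum over all $\delta$-hyperedges $h$ of the number of hyperedges in the maximal tree of $\delta$-hyperedges whose root (input)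 is the first target of $h$. Let $\preceq_U,\preceq_M,\preceq_\mu,\preceq_\delta,\preceq_{\mathcal L}$ compare, respectively, the numbers of U-paths, of M-paths, of $\mu$-hyperedges, of $\delta$-hyperedges, and the L-weights of monogamous acyclic $(n,m)$-hypergraphs, and let $\preceq_{\mathsf{BA}}$ be their lexicographic combination, in this order. A preorder $\preceq$ whose strict part $\prec$ has no infinite decreasing chains is a *reduction ordering* (*weak reduction ordering*) for a rewriting system if every step from $G$ to $H$ satisfies $H\prec G$ (respectively $H\preceq G$). **Theorem.** For all $n,m$, $\preceq_{\mathsf{BA}}$ is a reduction ordering for $\mathsf{BA}$. More precisely, for each of the ten rules there is one of the five components, independent of $n,m$, that is a reduction ordering for this rule alone, while every earlier component is a weak reduction ordering for it. Consequently $\mathsf{BA}$ terminates: there is no infinite sequence of rewriting steps starting from a monogamous acyclic hypergraph with interfaces. -/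

import Mathlib

namespace ConvexRewriting

open CategoryTheory

/-! ## Labelled hypergraphs -/

/-- A (one-sorted) monoidal signature: operations with an arity and a coarity. -/
structure Signature where
  Op : Type
  ar : Op → ℕ
  coar : Op → ℕ

/-- A finite directed hypergraph whose hyperedges are labelled in `S`: a set `V` of nodes and, for
each operation `o`, a set `E o` of hyperedges labelled `o`, each having `ar o` ordered sources and
`coar o` ordered targets. -/
structure Hypergraph (S : Signature) where
  V : Type
  E : S.Op → Type
  src : ∀ o, E o → Fin (S.ar o) → V
  tgt : ∀ o, E o → Fin (S.coar o) → V
  finite_V : Finite V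
  finite_E : Finite (Σ o, E o)

/-- Label-preserving homomorphisms of hypergraphs. -/
@[ext]
structure Hypergraph.Hom {S : Signature} (G H : Hypergraph S) where
  onV : G.V → H.V
  onE : ∀ o, G.E o → H.E o
  src_comm : ∀ o e i, onV (G.src o e i) = H.src o (onE o e) i
  tgt_comm : ∀ o e i, onV (G.tgt o e i) = H.tgt o (onE o e) i

instance Hypergraph.category (S : Signature) : Category (Hypergraph S) where
  Hom G H := Hypergraph.Hom G H
  id G :=
    { onV := fun v => v
      onE := fun _ e => e
      src_comm := fun _ _ _ => rfl
      tgt_comm := fun _ _ _ => rfl }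
  comp f g :=
    { onV := fun v => g.onV (f.onV v)
      onE := fun o e => g.onE o (f.onE o e)
      src_comm := fun o e i => by rw [f.src_comm, g.src_comm]
      tgt_comm := fun o e i => by rw [f.tgt_comm, g.tgt_comm] }

/-- The underlying map on nodes of a morphism. -/
def onNode {S : Signature} {G H : Hypergraph S} (f : G ⟶ H) : G.V → H.V :=
  Hypergraph.Hom.onV f

/-- The underlying maps on hyperedges of a morphism. -/
def onEdge {S : Signature} {G H : Hypergraph S} (f : G ⟶ H) (o : S.Op) : G.E o → H.E o :=
  Hypergraph.Hom.onE f o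

/-- The discrete hypergraph on a finite set: no hyperedges. -/
def discrete (S : Signature) (X : Type) [Finite X] : Hypergraph S where
  V := X
  E := fun _ => Empty
  src := fun _ e => e.elim
  tgt := fun _ e => e.elim
  finite_V := inferInstance
  finite_E := Finite.of_surjective (fun e : Empty => e.elim) (fun e => e.2.elim)

/-- The morphism out of a discrete hypergraph given by a function on nodes. -/
def ofNodes {S : Signature} {X : Type} [Finite X] {G : Hypergraph S} (f : X → G.V) :
    discrete S X ⟶ G :=
  ({ onV := f
     onE := fun _ e => e.elim
     src_comm := fun _ e => e.elim
     tgt_comm := fun _ e => e.elim } : Hypergraph.Hom (discrete S X) G)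

/-- The copairing `[f, g]` of two morphisms out of discrete hypergraphs. -/
def copair {S : Signature} {X Y : Type} [Finite X] [Finite Y] {G : Hypergraph S}
    (f : discrete S X ⟶ G) (g : discrete S Y ⟶ G) : discrete S (X ⊕ Y) ⟶ G :=
  ofNodes (Sum.elim (onNode f) (onNode g))

/-- A hypergraph with interfaces, i.e. a cospan `X ⟶ G ⟵ Y` with discrete feet. -/
structure IHyp (S : Signature) (X Y : Type) [Finite X] [Finite Y] where
  G : Hypergraph S
  inp : discrete S X ⟶ G
  out : discrete S Y ⟶ G

namespace Hypergraph

variable {S : Signature}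

/-- All hyperedges, of any label. -/
abbrev Edge (G : Hypergraph S) : Type := Σ o, G.E o

/-- `v` is one of the sources of `h`. -/
def IsSource (G : Hypergraph S) (v : G.V) (h : G.Edge) : Prop := ∃ i, G.src h.1 h.2 i = v

/-- `v` is one of the targets of `h`. -/
def IsTarget (G : Hypergraph S) (v : G.V) (h : G.Edge) : Prop := ∃ i, G.tgt h.1 h.2 i = v

/-- The number of pairs `(h, i)` such that `v` is the `i`-th target of `h`. -/
noncomputable def inDegree (G : Hypergraph S) (v : G.V) : ℕ :=
  Nat.card {p : Σ h : G.Edge, Fin (S.coar h.1) // G.tgt p.1.1 p.1.2 p.2 = v}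

/-- The number of pairs `(h, i)` such that `v` is the `i`-th source of `h`. -/
noncomputable def outDegree (G : Hypergraph S) (v : G.V) : ℕ :=
  Nat.card {p : Σ h : G.Edge, Fin (S.ar h.1) // G.src p.1.1 p.1.2 p.2 = v}

/-- A directed path from the hyperedge `h` to the hyperedge `l`: a non-empty sequence of hyperedges
`[h₁, …, hₙ]` with `h₁ = h`, `hₙ = l`, where each `hᵢ₊₁` is a successor of `hᵢ`. The path records
the node, a target of `hᵢ` and a source of `hᵢ₊₁`, through which it passes from `hᵢ` to `hᵢ₊₁`. -/
inductive Path (G : Hypergraph S) : G.Edge → G.Edge → Type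
  | single (h : G.Edge) : Path G h h
  | cons (h : G.Edge) {k l : G.Edge} (v : G.V) (hv : G.IsTarget v h) (hk : G.IsSource v k)
      (p : Path G k l) : Path G h l

/-- The sequence of hyperedges of a path. -/
def Path.edges {G : Hypergraph S} : {h l : G.Edge} → G.Path h l → List G.Edge
  | _, _, .single h => [h]
  | _, _, .cons h _ _ _ p => h :: p.edges

/-- There is no path from a node to itself. -/
def Acyclic (G : Hypergraph S) : Prop :=
  ∀ (v : G.V) (h l : G.Edge) (_ : G.Path h l), G.IsSource v h → ¬ G.IsTarget v l

end Hypergraph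

/-- A convex matching: a monomorphism such that every path of `G` between nodes of its image
consists of hyperedges of its image. -/
def IsConvexMatching {S : Signature} {L G : Hypergraph S} (f : L ⟶ G) : Prop :=
  Mono f ∧
    ∀ (v w : L.V) (h l : G.Edge) (p : G.Path h l),
      G.IsSource (onNode f v) h → G.IsTarget (onNode f w) l →
        ∀ e ∈ p.edges, ∃ e' : L.E e.1, onEdge f e.1 e' = e.2

namespace IHyp

variable {S : Signature} {X Y : Type} [Finite X] [Finite Y]

/-- `v` is an input of the hypergraph with interfaces. -/
def IsInput (D : IHyp S X Y) (v : D.G.V) : Prop := ∃ x : X, onNode D.inp x = v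

/-- `v` is an output of the hypergraph with interfaces. -/
def IsOutput (D : IHyp S X Y) (v : D.G.V) : Prop := ∃ y : Y, onNode D.out y = v

/-- Monogamy: both legs are mono; inputs have in-degree 0 and other nodes in-degree 1; outputs have
out-degree 0 and other nodes out-degree 1. -/
structure Monogamous (D : IHyp S X Y) : Prop where
  mono_inp : Mono D.inp
  mono_out : Mono D.out
  inDegree_input : ∀ v, D.IsInput v → D.G.inDegree v = 0
  inDegree_other : ∀ v, ¬ D.IsInput v → D.G.inDegree v = 1
  outDegree_output : ∀ v, D.IsOutput v → D.G.outDegree v = 0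
  outDegree_other : ∀ v, ¬ D.IsOutput v → D.G.outDegree v = 1

/-- Monogamous acyclic hypergraphs with interfaces, the combinatorial form of string diagrams. -/
structure MonogamousAcyclic (D : IHyp S X Y) : Prop where
  monogamous : D.Monogamous
  acyclic : D.G.Acyclic

end IHyp

/-- Monogamous acyclic hypergraphs with `n` inputs and `m` outputs. -/
abbrev MAHyp (S : Signature) (n m : ℕ) : Type 1 :=
  {D : IHyp S (Fin n) (Fin m) // D.MonogamousAcyclic}

/-! ## Convex DPOI rewriting -/

/-- A rewriting rule: two hypergraphs with the same interfaces, i.e. a span `L ⟵ i + j ⟶ R`. -/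
structure Rule (S : Signature) where
  i : ℕ
  j : ℕ
  lhs : IHyp S (Fin i) (Fin j)
  rhs : IHyp S (Fin i) (Fin j)

/-- `D` rewrites convexly into `E` by the rule `ρ`, with interface `X + Y`: there are a context
`C` with morphisms `[c₁, c₂] : i + j ⟶ C` and `[d₁, d₂] : X + Y ⟶ C` and a double pushout diagram
```
      L <--- i+j ---> R
      |f      |       |f'
      v       v       v
      D <-g-- C --g'-> E
```
compatible with the interfaces of `D` and `E`, in which `f` is a convex matching and the left
square is a boundary complement, i.e. `[c₁, c₂]` is mono and
`j + X --[c₂, d₁]--> C <--[d₂, c₁]-- Y + i` is monogamous. -/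
def RuleStep {S : Signature} (ρ : Rule S) {X Y : Type} [Finite X] [Finite Y]
    (D E : IHyp S X Y) : Prop :=
  ∃ (C : Hypergraph S)
    (c₁ : discrete S (Fin ρ.i) ⟶ C) (c₂ : discrete S (Fin ρ.j) ⟶ C)
    (d₁ : discrete S X ⟶ C) (d₂ : discrete S Y ⟶ C)
    (f : ρ.lhs.G ⟶ D.G) (g : C ⟶ D.G) (f' : ρ.rhs.G ⟶ E.G) (g' : C ⟶ E.G),
    IsPushout (copair ρ.lhs.inp ρ.lhs.out) (copair c₁ c₂) f g ∧
    IsPushout (copair ρ.rhs.inp ρ.rhs.out) (copair c₁ c₂) f' g' ∧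
    d₁ ≫ g = D.inp ∧ d₂ ≫ g = D.out ∧
    d₁ ≫ g' = E.inp ∧ d₂ ≫ g' = E.out ∧
    IsConvexMatching f ∧
    Mono (copair c₁ c₂) ∧
    (IHyp.mk C (copair c₂ d₁) (copair d₂ c₁)).Monogamous

/-- The convex DPOI rewriting relation of a rewriting system. -/
def Step {S : Signature} (R : Set (Rule S)) {X Y : Type} [Finite X] [Finite Y]
    (D E : IHyp S X Y) : Prop :=
  ∃ ρ ∈ R, RuleStep ρ D E

/-- A rewriting system is terminating if there is no infinite sequence of rewriting steps starting
from a monogamous acyclic hypergraph with interfaces. -/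
def Terminating {S : Signature} (R : Set (Rule S)) : Prop :=
  ∀ n m : ℕ, ¬ ∃ s : ℕ → IHyp S (Fin n) (Fin m),
    (s 0).MonogamousAcyclic ∧ ∀ k, Step R (s k) (s (k + 1))

/-! ## Reduction orderings -/

/-- The equivalence relation of a preorder. -/
def EquivRel {α : Type*} (le : α → α → Prop) (a b : α) : Prop := le a b ∧ le b a

/-- The strict ordering of a preorder. -/
def StrictRel {α : Type*} (le : α → α → Prop) (a b : α) : Prop := le a b ∧ ¬ EquivRel le a b

/-- The lexicographic combination of two preorders. -/
def LexRel {α : Type*} (le₁ le₂ : α → α → Prop) (a b : α) : Prop :=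
  StrictRel le₁ a b ∨ (EquivRel le₁ a b ∧ le₂ a b)

/-- A well-founded preorder: its strict part has no infinite decreasing chains. -/
structure IsWellFoundedPreorder {α : Type*} (le : α → α → Prop) : Prop where
  refl : ∀ a, le a a
  trans : ∀ a b c, le a b → le b c → le a c
  wf : WellFounded (StrictRel le)

/-- Reduction orderings for a rewriting system, on hypergraphs with `n` inputs, `m` outputs. -/
structure IsReductionOrdering {S : Signature} {n m : ℕ} (R : Set (Rule S))
    (le : MAHyp S n m → MAHyp S n m → Prop) : Prop extends IsWellFoundedPreorder le where
  decreases : ∀ G H : MAHyp S n m, Step R G.1 H.1 → StrictRel le H G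

/-- Weak reduction orderings. -/
structure IsWeakReductionOrdering {S : Signature} {n m : ℕ} (R : Set (Rule S))
    (le : MAHyp S n m → MAHyp S n m → Prop) : Prop extends IsWellFoundedPreorder le where
  nonincreasing : ∀ G H : MAHyp S n m, Step R G.1 H.1 → le H G

/-! ## Bialgebras -/

/-- The generators of bialgebras: `μ : 2 → 1`, `η : 0 → 1`, `δ : 1 → 2`, `ε : 1 → 0`. -/
inductive BialgOp
  | mu
  | eta
  | delta
  | eps

/-- The signature of bialgebras. -/
def bialg : Signature where
  Op := BialgOp
  ar := fun o => match o with
    | .mu => 2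
    | .eta => 0
    | .delta => 1
    | .eps => 1
  coar := fun o => match o with
    | .mu => 1
    | .eta => 1
    | .delta => 2
    | .eps => 0

instance : Finite bialg.Op :=
  Finite.of_surjective (α := Fin 4) (β := BialgOp) ![.mu, .eta, .delta, .eps] (fun o => by
    cases o
    exacts [⟨0, rfl⟩, ⟨1, rfl⟩, ⟨2, rfl⟩, ⟨3, rfl⟩])

/-- The hypergraph with nodes `0, …, k - 1` and the listed hyperedges: `(a, b, c)` in `mus` is a
`μ` with sources `a, b` and target `c`; `a` in `etas` is an `η` with target `a`; `(a, b, c)` in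
`deltas` is a `δ` with source `a` and targets `b, c`; `a` in `epss` is an `ε` with source `a`. -/
def mkHyp (k : ℕ) (mus : List (Fin k × Fin k × Fin k)) (etas : List (Fin k))
    (deltas : List (Fin k × Fin k × Fin k)) (epss : List (Fin k)) : Hypergraph bialg where
  V := Fin k
  E := fun o => match o with
    | .mu => Fin mus.length
    | .eta => Fin etas.length
    | .delta => Fin deltas.length
    | .eps => Fin epss.length
  src := fun o => match o with
    | .mu => fun e => ![(mus.get e).1, (mus.get e).2.1]
    | .eta => fun _ => ![]
    | .delta => fun e => ![(deltas.get e).1]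
    | .eps => fun e => ![epss.get e]
  tgt := fun o => match o with
    | .mu => fun e => ![(mus.get e).2.2]
    | .eta => fun e => ![etas.get e]
    | .delta => fun e => ![(deltas.get e).2.1, (deltas.get e).2.2]
    | .eps => fun _ => ![]
  finite_V := inferInstance
  finite_E := by
    have : ∀ o : bialg.Op, Finite (match o with
      | .mu => Fin mus.length
      | .eta => Fin etas.length
      | .delta => Fin deltas.length
      | .eps => Fin epss.length : Type) := by
      intro o
      cases o <;> exact inferInstanceAs (Finite (Fin _))
    exact inferInstance

/-- `mkHyp` with its list of input nodes and its list of output nodes. -/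
def mkIHyp (k : ℕ) (mus : List (Fin k × Fin k × Fin k)) (etas : List (Fin k))
    (deltas : List (Fin k × Fin k × Fin k)) (epss : List (Fin k)) {i j : ℕ}
    (inp : Fin i → Fin k) (out : Fin j → Fin k) : IHyp bialg (Fin i) (Fin j) where
  G := mkHyp k mus etas deltas epss
  inp := ofNodes (G := mkHyp k mus etas deltas epss) inp
  out := ofNodes (G := mkHyp k mus etas deltas epss) out

/-- Associativity: `μ(μ(x, y), z) ⟶ μ(x, μ(y, z))`. -/
def BA1 : Rule bialg where
  i := 3
  j := 1
  lhs := mkIHyp 5 [(0, 1, 3), (3, 2, 4)] [] [] [] ![0, 1, 2] ![4]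
  rhs := mkIHyp 5 [(1, 2, 3), (0, 3, 4)] [] [] [] ![0, 1, 2] ![4]

/-- Coassociativity, from the left-nested to the right-nested `δ`-tree. -/
def BA2 : Rule bialg where
  i := 1
  j := 3
  lhs := mkIHyp 5 [] [] [(0, 1, 4), (1, 2, 3)] [] ![0] ![2, 3, 4]
  rhs := mkIHyp 5 [] [] [(0, 2, 1), (1, 3, 4)] [] ![0] ![2, 3, 4]

/-- Left unit: `μ(η, x) ⟶ x`. -/
def BA3 : Rule bialg where
  i := 1
  j := 1
  lhs := mkIHyp 3 [(1, 0, 2)] [1] [] [] ![0] ![2]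
  rhs := mkIHyp 1 [] [] [] [] ![0] ![0]

/-- Right unit: `μ(x, η) ⟶ x`. -/
def BA4 : Rule bialg where
  i := 1
  j := 1
  lhs := mkIHyp 3 [(0, 1, 2)] [1] [] [] ![0] ![2]
  rhs := mkIHyp 1 [] [] [] [] ![0] ![0]

/-- Left counit: discarding the first output of `δ`. -/
def BA5 : Rule bialg where
  i := 1
  j := 1
  lhs := mkIHyp 3 [] [] [(0, 1, 2)] [1] ![0] ![2]
  rhs := mkIHyp 1 [] [] [] [] ![0] ![0]

/-- Right counit: discarding the second output of `δ`. -/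
def BA6 : Rule bialg where
  i := 1
  j := 1
  lhs := mkIHyp 3 [] [] [(0, 1, 2)] [2] ![0] ![1]
  rhs := mkIHyp 1 [] [] [] [] ![0] ![0]

/-- `η ; δ ⟶ η ⊕ η`. -/
def BA7 : Rule bialg where
  i := 0
  j := 2
  lhs := mkIHyp 3 [] [0] [(0, 1, 2)] [] ![] ![1, 2]
  rhs := mkIHyp 2 [] [0, 1] [] [] ![] ![0, 1]

/-- `μ ; ε ⟶ ε ⊕ ε`. -/
def BA8 : Rule bialg where
  i := 2
  j := 0
  lhs := mkIHyp 3 [(0, 1, 2)] [] [] [2] ![0, 1] ![]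
  rhs := mkIHyp 2 [] [] [] [0, 1] ![0, 1] ![]

/-- `μ ; δ ⟶ (δ ⊕ δ) ; (id ⊕ σ ⊕ id) ; (μ ⊕ μ)`. -/
def BA9 : Rule bialg where
  i := 2
  j := 2
  lhs := mkIHyp 5 [(0, 1, 2)] [] [(2, 3, 4)] [] ![0, 1] ![3, 4]
  rhs := mkIHyp 8 [(2, 4, 6), (3, 5, 7)] [] [(0, 2, 3), (1, 4, 5)] [] ![0, 1] ![6, 7]

/-- `η ; ε ⟶ id₀` (the empty diagram). -/
def BA10 : Rule bialg where
  i := 0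
  j := 0
  lhs := mkIHyp 1 [] [0] [] [0] ![] ![]
  rhs := mkIHyp 0 [] [] [] [] ![] ![]

/-- The DPOI rewriting system of non-commutative bialgebras. -/
def BA : Set (Rule bialg) := {BA1, BA2, BA3, BA4, BA5, BA6, BA7, BA8, BA9, BA10}

section Metrics

variable {n m : ℕ}

/-- A U-path: a path from an input or an `η`-hyperedge to an output or an `ε`-hyperedge. -/
structure UPath (D : IHyp bialg (Fin n) (Fin m)) where
  first : D.G.Edge
  last : D.G.Edge
  path : D.G.Path first last
  start : {v : D.G.V // D.IsInput v ∧ D.G.IsSource v first} ⊕ PLift (first.1 = BialgOp.eta)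
  finish : {v : D.G.V // D.IsOutput v ∧ D.G.IsTarget v last} ⊕ PLift (last.1 = BialgOp.eps)

/-- An M-path: a path from a `μ`-hyperedge to a `δ`-hyperedge. -/
structure MPath (D : IHyp bialg (Fin n) (Fin m)) where
  first : D.G.E BialgOp.mu
  last : D.G.E BialgOp.delta
  path : D.G.Path ⟨BialgOp.mu, first⟩ ⟨BialgOp.delta, last⟩

/-- The `μ`-hyperedges of the (maximal) `μ`-tree with root `x`: the `μ`-hyperedge with output `x`,
if any, and with each `μ`-hyperedge those whose output is one of its two inputs. -/
inductive InMuTree (G : Hypergraph bialg) (x : G.V) : G.E BialgOp.mu → Prop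
  | root (h : G.E BialgOp.mu) (hx : G.tgt BialgOp.mu h (0 : Fin 1) = x) : InMuTree G x h
  | child (h k : G.E BialgOp.mu) (i : Fin 2) (hh : InMuTree G x h)
      (hk : G.tgt BialgOp.mu k (0 : Fin 1) = G.src BialgOp.mu h i) : InMuTree G x k

/-- The `δ`-hyperedges of the (maximal) `δ`-tree with root `x`. -/
inductive InDeltaTree (G : Hypergraph bialg) (x : G.V) : G.E BialgOp.delta → Prop
  | root (h : G.E BialgOp.delta) (hx : G.src BialgOp.delta h (0 : Fin 1) = x) : InDeltaTree G x h
  | child (h k : G.E BialgOp.delta) (i : Fin 2) (hh : InDeltaTree G x h)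
      (hk : G.src BialgOp.delta k (0 : Fin 1) = G.tgt BialgOp.delta h i) : InDeltaTree G x k

/-- The L-weight of a hypergraph: the sum, over the `μ`-hyperedges, of the size of the `μ`-tree at
the first input and, over the `δ`-hyperedges, of the size of the `δ`-tree at the first output. -/
noncomputable def LWeight (G : Hypergraph bialg) : ℕ :=
  (∑ᶠ h : G.E BialgOp.mu, Nat.card {k // InMuTree G (G.src BialgOp.mu h (0 : Fin 2)) k}) +
  (∑ᶠ h : G.E BialgOp.delta, Nat.card {k // InDeltaTree G (G.tgt BialgOp.delta h (0 : Fin 2)) k})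

/-- Comparison of the numbers of U-paths. -/
def leU (H G : MAHyp bialg n m) : Prop := ENat.card (UPath H.1) ≤ ENat.card (UPath G.1)

/-- Comparison of the numbers of M-paths. -/
def leM (H G : MAHyp bialg n m) : Prop := ENat.card (MPath H.1) ≤ ENat.card (MPath G.1)

/-- Comparison of the numbers of `μ`-hyperedges. -/
def leMu (H G : MAHyp bialg n m) : Prop :=
  Nat.card (H.1.G.E BialgOp.mu) ≤ Nat.card (G.1.G.E BialgOp.mu)

/-- Comparison of the numbers of `δ`-hyperedges. -/
def leDelta (H G : MAHyp bialg n m) : Prop :=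
  Nat.card (H.1.G.E BialgOp.delta) ≤ Nat.card (G.1.G.E BialgOp.delta)

/-- Comparison of the L-weights. -/
def leL (H G : MAHyp bialg n m) : Prop := LWeight H.1.G ≤ LWeight G.1.G

/-- The five components of the ordering, in order of priority. -/
def component (n m : ℕ) : Fin 5 → MAHyp bialg n m → MAHyp bialg n m → Prop :=
  ![leU, leM, leMu, leDelta, leL]

/-- The lexicographic ordering by U-paths, M-paths, `μ`-hyperedges, `δ`-hyperedges, L-weight. -/
def leBA (n m : ℕ) : MAHyp bialg n m → MAHyp bialg n m → Prop :=
  LexRel leU (LexRel leM (LexRel leMu (LexRel leDelta leL)))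

end Metrics

end ConvexRewriting

namespace ConvexRewriting

open CategoryTheory

/-! ### Pushouts of hypergraphs on nodes and hyperedges -/

section Category

variable {S : Signature}

/-! Four of the five quantities are handled by one device or are trivial. Numbers of `μ`- and
`δ`-hyperedges change by a constant depending only on the rule. The numbers of U-paths and M-paths
and both halves of the L-weight are sums, over inputs or over hyperedges of one kind, of a node
function computed from the outputs backwards by a local recipe (`Weight`): the value at a source of
a hyperedge is a monotone function of the values at its targets. For U-paths the value counts the
ways to reach an output or an `ε`, for M-paths the ways to reach a `δ`. In the L-weight, the
`δ`-trees grow along the direction of the hyperedges and fit directly; the `μ`-trees grow against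
it, so the sum is first transposed: for a `μ`-hyperedge `k`, one counts the `h` whose first source
lies on the chain of `μ`s descending from `k`.

A step replaces one side of a rule by the other inside a common context `C`. If the values at the
inputs of the rule do not increase whenever those at its outputs do not (`Weight.Compatible`),
induction on a height function of the acyclic diagram shows that no value at a node of `C` increases
(`Decomposition.weight_le`), and summation gives the global inequality
(`Decomposition.tgtSum_add_le`). For each concrete rule this leaves linear inequalities between a
few numbers.

Strictness: rules 3, 4 and 10 delete an `η`, from which at least one U-path starts; rules 5 and 6
lower the value at the input of the rule, and the drop travels backwards to an input of the diagram
or to an `η` (`Decomposition.exists_lt`). Rule 9 deletes the M-path from its `μ` to its `δ`, rule 8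
a `μ`, rule 7 a `δ`, and rules 1 and 2 lower the L-weight.

Termination further requires that steps preserve monogamous acyclicity
(`RuleStep.monogamousAcyclic`). Monogamy is restated as two bijections, which glue along pushouts;
acyclicity uses convexity of the match, which excludes a return path through the context from an
output of the rule to an input. -/

theorem onNode_src {G H : Hypergraph S} (f : G ⟶ H) (o : S.Op) (e : G.E o) (i : Fin (S.ar o)) :
    onNode f (G.src o e i) = H.src o (onEdge f o e) i :=
  Hypergraph.Hom.src_comm f o e i

theorem onNode_tgt {G H : Hypergraph S} (f : G ⟶ H) (o : S.Op) (e : G.E o) (i : Fin (S.coar o)) :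
    onNode f (G.tgt o e i) = H.tgt o (onEdge f o e) i :=
  Hypergraph.Hom.tgt_comm f o e i

theorem hom_ext {G H : Hypergraph S} {f g : G ⟶ H} (hV : ∀ v, onNode f v = onNode g v)
    (hE : ∀ o e, onEdge f o e = onEdge g o e) : f = g :=
  Hypergraph.Hom.ext (funext hV) (funext fun o => funext fun e => hE o e)

theorem hom_ext_discrete {X : Type} [Finite X] {G : Hypergraph S} {f g : discrete S X ⟶ G}
    (h : ∀ x : X, onNode f x = onNode g x) : f = g :=
  hom_ext h fun _ e => e.elim

theorem mono_of_injective {G H : Hypergraph S} (f : G ⟶ H) (hV : Function.Injective (onNode f))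
    (hE : ∀ o, Function.Injective (onEdge f o)) : Mono f where
  right_cancellation a b hab := by
    refine hom_ext (fun v => hV ?_) fun o e => hE o ?_
    · exact congrArg (fun k => onNode k v) hab
    · exact congrArg (fun k => onEdge k o e) hab

/-- Nodes are morphisms out of the one-node discrete hypergraph, and `f` can be cancelled from
these. -/
theorem injective_onNode_of_mono {G H : Hypergraph S} (f : G ⟶ H) [Mono f] :
    Function.Injective (onNode f) := by
  intro v w hvw
  have key : (ofNodes (X := Unit) fun _ => v) = (ofNodes (X := Unit) fun _ => w) :=
    (cancel_mono f).1 (hom_ext_discrete fun _ => hvw)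
  exact congrArg (fun k => onNode k ()) key

theorem mono_discrete_iff {X : Type} [Finite X] {G : Hypergraph S} (f : discrete S X ⟶ G) :
    Mono f ↔ Function.Injective (onNode f) :=
  ⟨fun _ => injective_onNode_of_mono f, fun h => mono_of_injective f h fun _ e => e.elim⟩

/-- The hypergraph on the nodes `X` having, for each label `o` and each choice of sources and
targets, the hyperedges `Z o`: morphisms into it are arbitrary functions to `X` and to `Z`. -/
def codiscrete (S : Signature) [Finite S.Op] (X : Type) [Finite X] (Z : S.Op → Type)
    [∀ o, Finite (Z o)] : Hypergraph S where
  V := X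
  E o := (Fin (S.ar o) → X) × (Fin (S.coar o) → X) × Z o
  src _ e := e.1
  tgt _ e := e.2.1
  finite_V := inferInstance
  finite_E := inferInstance

/-- The morphism into a codiscrete hypergraph given by functions on nodes and on hyperedges. -/
def toCodiscrete [Finite S.Op] {X : Type} [Finite X] {Z : S.Op → Type} [∀ o, Finite (Z o)]
    {G : Hypergraph S} (a : G.V → X) (z : ∀ o, G.E o → Z o) : G ⟶ codiscrete S X Z :=
  ({ onV := a
     onE := fun o e => (fun i => a (G.src o e i), fun i => a (G.tgt o e i), z o e)
     src_comm := fun _ _ _ => rfl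
     tgt_comm := fun _ _ _ => rfl } : Hypergraph.Hom G (codiscrete S X Z))

instance Hypergraph.instFiniteV (G : Hypergraph S) : Finite G.V := G.finite_V

instance Hypergraph.instFiniteEdge (G : Hypergraph S) : Finite G.Edge := G.finite_E

instance Hypergraph.instFiniteE (G : Hypergraph S) (o : S.Op) : Finite (G.E o) :=
  Finite.of_injective (fun e => (⟨o, e⟩ : G.Edge)) fun a b h => by simpa using h

theorem hom_ext_codiscrete [Finite S.Op] {X : Type} [Finite X] {Z : S.Op → Type}
    [∀ o, Finite (Z o)] {G : Hypergraph S} {p q : G ⟶ codiscrete S X Z}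
    (hV : ∀ v, (onNode p v : X) = onNode q v)
    (hE : ∀ o e, (onEdge p o e).2.2 = (onEdge q o e).2.2) : p = q := by
  refine hom_ext hV fun o e => Prod.ext (funext fun i => ?_) (Prod.ext (funext fun i => ?_) (hE o e))
  · exact (onNode_src p o e i).symm.trans ((hV _).trans (onNode_src q o e i))
  · exact (onNode_tgt p o e i).symm.trans ((hV _).trans (onNode_tgt q o e i))

section Pushout

variable {X : Type} [Finite X] {L C D : Hypergraph S}
  {u : discrete S X ⟶ L} {c : discrete S X ⟶ C} {f : L ⟶ D} {g : C ⟶ D}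

theorem pushout_node_comm (h : IsPushout u c f g) (x : X) :
    onNode f (onNode u x) = onNode g (onNode c x) := by
  have := congrArg (fun k : discrete S X ⟶ D => onNode k x) h.w
  exact this

variable [Finite S.Op]

/-- A morphism into a codiscrete hypergraph is free on nodes, so the universal property among
hypergraphs yields the universal property of the pushout of node sets. -/
theorem exists_desc_node (h : IsPushout u c f g) {Z : Type} (a : L.V → Z) (b : C.V → Z)
    (hab : ∀ x : X, a (onNode u x) = b (onNode c x)) :
    ∃ d : D.V → Z, (∀ v, d (onNode f v) = a v) ∧ ∀ v, d (onNode g v) = b v := by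
  let T := Set.range (Sum.elim a b)
  let a' : L.V → T := fun v => ⟨a v, Sum.inl v, rfl⟩
  let b' : C.V → T := fun v => ⟨b v, Sum.inr v, rfl⟩
  let α : L ⟶ codiscrete S T fun _ => Unit := toCodiscrete a' fun _ _ => ()
  let β : C ⟶ codiscrete S T fun _ => Unit := toCodiscrete b' fun _ _ => ()
  have w : u ≫ α = c ≫ β := hom_ext_discrete fun x => Subtype.ext (hab x)
  refine ⟨fun v => (onNode (h.desc α β w) v : T).1, fun v => ?_, fun v => ?_⟩
  · have := congrArg (fun k : L ⟶ codiscrete S T fun _ => Unit => (onNode k v : T).1)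
      (h.inl_desc α β w)
    exact this
  · have := congrArg (fun k : C ⟶ codiscrete S T fun _ => Unit => (onNode k v : T).1)
      (h.inr_desc α β w)
    exact this

/-- The indicator function of the joint image and the constant `True` agree on `L` and on `C`, hence
on the pushout. `Prop` serves as a two-element set of nodes. -/
theorem pushout_node_surjective (h : IsPushout u c f g) (v : D.V) :
    (∃ x, onNode f x = v) ∨ ∃ y, onNode g y = v := by
  let P : D.V → Prop := fun v => (∃ x, onNode f x = v) ∨ ∃ y, onNode g y = v
  let α : D ⟶ codiscrete S Prop fun _ => Unit := toCodiscrete P fun _ _ => ()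
  let β : D ⟶ codiscrete S Prop fun _ => Unit := toCodiscrete (fun _ => True) fun _ _ => ()
  have key : α = β := h.hom_ext
    (hom_ext_codiscrete (fun x => eq_true (Or.inl ⟨x, rfl⟩)) fun _ _ => rfl)
    (hom_ext_codiscrete (fun x => eq_true (Or.inr ⟨x, rfl⟩)) fun _ _ => rfl)
  exact of_eq_true (congrArg (fun k : D ⟶ codiscrete S Prop fun _ => Unit =>
    (onNode k v : Prop)) key)

/-- The interface has no hyperedges, so on hyperedges the pushout is a coproduct. The test objects
have a single node and carry the information in the extra label of their hyperedges. -/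
theorem pushout_edge_bijective (h : IsPushout u c f g) (o : S.Op) :
    Function.Bijective (Sum.elim (onEdge f o) (onEdge g o)) := by
  constructor
  · let α : L ⟶ codiscrete S Unit fun o => L.E o ⊕ C.E o :=
      toCodiscrete (fun _ => ()) fun _ e => Sum.inl e
    let β : C ⟶ codiscrete S Unit fun o => L.E o ⊕ C.E o :=
      toCodiscrete (fun _ => ()) fun _ e => Sum.inr e
    have w : u ≫ α = c ≫ β := hom_ext_discrete fun _ => rfl
    refine Function.LeftInverse.injective (g := fun e => (onEdge (h.desc α β w) o e).2.2) ?_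
    rintro (e | e)
    · have := congrArg (fun k : L ⟶ codiscrete S Unit fun o => L.E o ⊕ C.E o =>
        (onEdge k o e).2.2) (h.inl_desc α β w)
      exact this
    · have := congrArg (fun k : C ⟶ codiscrete S Unit fun o => L.E o ⊕ C.E o =>
        (onEdge k o e).2.2) (h.inr_desc α β w)
      exact this
  · intro e
    let P : ∀ o, D.E o → Prop := fun o e => ∃ a, Sum.elim (onEdge f o) (onEdge g o) a = e
    let α : D ⟶ codiscrete S Unit fun _ => Prop := toCodiscrete (fun _ => ()) P
    let β : D ⟶ codiscrete S Unit fun _ => Prop := toCodiscrete (fun _ => ()) fun _ _ => True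
    have key : α = β := h.hom_ext
      (hom_ext_codiscrete (fun _ => rfl) fun o e => eq_true ⟨Sum.inl e, rfl⟩)
      (hom_ext_codiscrete (fun _ => rfl) fun o e => eq_true ⟨Sum.inr e, rfl⟩)
    exact of_eq_true (congrArg (fun k : D ⟶ codiscrete S Unit fun _ => Prop =>
      (onEdge k o e).2.2) key)

/-- A left inverse of `g` with values in `Option C.V` is obtained by descent: the interface nodes of
`L` go to their partners in `C`, unambiguously since `u` is injective, and all other nodes of `L` go
to `none`. -/
theorem pushout_inr_injective (h : IsPushout u c f g) (hu : Function.Injective (onNode u)) :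
    Function.Injective (onNode g) := by
  classical
  obtain ⟨d, -, hd⟩ := exists_desc_node h
    (fun v => if hv : ∃ x : X, onNode u x = v then some (onNode c hv.choose) else none) some
    (fun x => by
      have hx : ∃ y : X, onNode u y = onNode u x := ⟨x, rfl⟩
      simp only [hx, dite_true]
      rw [hu hx.choose_spec])
  intro v w hvw
  exact Option.some_injective _ (by rw [← hd, ← hd, hvw])

end Pushout

end Category

/-! ### Monogamy as a pair of bijections -/

section Monogamy

theorem bijective_sumElim_iff {X T V : Type*} [Finite T] (f : X → V) (t : T → V) :
    Function.Bijective (Sum.elim f t) ↔ Function.Injective f ∧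
      (∀ v, (∃ x, f x = v) → Nat.card {p // t p = v} = 0) ∧
      ∀ v, (¬ ∃ x, f x = v) → Nat.card {p // t p = v} = 1 := by
  constructor
  · intro h
    refine ⟨fun x y hxy => Sum.inl_injective (h.1 hxy), ?_, ?_⟩
    · rintro v ⟨x, rfl⟩
      have : IsEmpty {p // t p = f x} := ⟨fun p => by
        cases h.1 (show Sum.elim f t (Sum.inr p.1) = Sum.elim f t (Sum.inl x) from p.2)⟩
      exact Nat.card_of_isEmpty
    · intro v hv
      rw [Nat.card_eq_one_iff_unique]
      refine ⟨⟨fun p q => Subtype.ext (Sum.inr_injective (h.1 (p.2.trans q.2.symm)))⟩, ?_⟩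
      obtain ⟨x | p, hp⟩ := h.2 v
      · exact (hv ⟨x, hp⟩).elim
      · exact ⟨⟨p, hp⟩⟩
  · rintro ⟨hf, h0, h1⟩
    have hft : ∀ x p, f x ≠ t p := fun x p hxp => by
      -- `Nat.card` also vanishes on infinite types; finiteness of `T` leaves only the empty fibre.
      have := (Nat.card_eq_zero.1 (h0 (f x) ⟨x, rfl⟩)).resolve_right (not_infinite_iff_finite.2 inferInstance)
      exact this.false ⟨p, hxp.symm⟩
    constructor
    · rintro (x | p) (y | q) hxy
      · exact congrArg _ (hf hxy)
      · exact (hft _ _ hxy).elim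
      · exact (hft _ _ hxy.symm).elim
      · have hq : t p = t q := hxy
        have hv : ¬ ∃ x, f x = t q := fun ⟨x, hx⟩ => hft _ _ hx
        have := (Nat.card_eq_one_iff_unique.1 (h1 _ hv)).1
        exact congrArg (fun s : {p // t p = t q} => Sum.inr s.1)
          (Subsingleton.elim ⟨p, hq⟩ ⟨q, rfl⟩)
    · intro v
      by_cases hv : ∃ x, f x = v
      · exact ⟨Sum.inl hv.choose, hv.choose_spec⟩
      · obtain ⟨p⟩ := (Nat.card_eq_one_iff_unique.1 (h1 _ hv)).2
        exact ⟨Sum.inr p.1, p.2⟩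

variable {S : Signature} {X Y : Type} [Finite X] [Finite Y]

/-- All pairs of a hyperedge and the index of one of its sources, with that source. -/
def Hypergraph.srcMap (G : Hypergraph S) (p : Σ h : G.Edge, Fin (S.ar h.1)) : G.V :=
  G.src p.1.1 p.1.2 p.2

/-- All pairs of a hyperedge and the index of one of its targets, with that target. -/
def Hypergraph.tgtMap (G : Hypergraph S) (p : Σ h : G.Edge, Fin (S.coar h.1)) : G.V :=
  G.tgt p.1.1 p.1.2 p.2

/-- Each node is exactly one of: an input, or a target of one hyperedge at one index; dually for
outputs and sources. Unlike the degree conditions, this form can be glued along pushouts. -/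
theorem IHyp.monogamous_iff (D : IHyp S X Y) : D.Monogamous ↔
    Function.Bijective (Sum.elim (onNode D.inp : X → D.G.V) D.G.tgtMap) ∧
    Function.Bijective (Sum.elim (onNode D.out : Y → D.G.V) D.G.srcMap) := by
  rw [bijective_sumElim_iff, bijective_sumElim_iff]
  constructor
  · intro h
    exact ⟨⟨(mono_discrete_iff _).1 h.mono_inp, h.inDegree_input, h.inDegree_other⟩,
      (mono_discrete_iff _).1 h.mono_out, h.outDegree_output, h.outDegree_other⟩
  · rintro ⟨⟨h1, h2, h3⟩, h4, h5, h6⟩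
    exact ⟨(mono_discrete_iff _).2 h1, (mono_discrete_iff _).2 h4, h2, h3, h5, h6⟩

end Monogamy

/-! ### Acyclicity and height functions -/

section Acyclic

variable {S : Signature}

/-- There is a hyperedge with source `v` and target `w`. -/
def Hypergraph.Adj (G : Hypergraph S) (v w : G.V) : Prop :=
  ∃ o e i j, G.src o e i = v ∧ G.tgt o e j = w

/-- A function on nodes which strictly decreases along hyperedges. -/
def Hypergraph.IsHeight (G : Hypergraph S) (r : G.V → ℕ) : Prop :=
  ∀ o e i j, r (G.tgt o e j) < r (G.src o e i)

theorem Hypergraph.IsHeight.comp {G H : Hypergraph S} {r : H.V → ℕ} (hr : H.IsHeight r)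
    (f : G ⟶ H) : G.IsHeight fun v => r (onNode f v) := by
  intro o e i j
  simpa only [onNode_src, onNode_tgt] using hr o (onEdge f o e) i j

/-- The last clause, that the first hyperedge comes from `G`, is what later contradicts convexity of
a match when `G` is the context. -/
theorem exists_path_of_transGen {G H : Hypergraph S} (f : G ⟶ H) {v w : G.V}
    (hvw : Relation.TransGen G.Adj v w) :
    ∃ (h l : H.Edge) (_ : H.Path h l), H.IsSource (onNode f v) h ∧ H.IsTarget (onNode f w) l ∧
      ∃ o e, h = ⟨o, onEdge f o e⟩ := by
  induction hvw using Relation.TransGen.head_induction_on with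
  | single h =>
    obtain ⟨o, e, i, j, rfl, rfl⟩ := h
    exact ⟨⟨o, onEdge f o e⟩, _, .single _, ⟨i, (onNode_src f o e i).symm⟩,
      ⟨j, (onNode_tgt f o e j).symm⟩, o, e, rfl⟩
  | head h _ ih =>
    obtain ⟨o, e, i, j, rfl, rfl⟩ := h
    obtain ⟨k, l, p, hk, hl, -⟩ := ih
    exact ⟨⟨o, onEdge f o e⟩, l, .cons _ _ ⟨j, (onNode_tgt f o e j).symm⟩ hk p,
      ⟨i, (onNode_src f o e i).symm⟩, hl, o, e, rfl⟩

theorem Hypergraph.Path.head_mem_edges {G : Hypergraph S} {h l : G.Edge} (p : G.Path h l) :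
    h ∈ p.edges := by
  cases p <;> simp [Hypergraph.Path.edges]

theorem Hypergraph.IsHeight.lt_of_path {G : Hypergraph S} {r : G.V → ℕ} (hr : G.IsHeight r)
    {h l : G.Edge} (p : G.Path h l) :
    ∀ v w, G.IsSource v h → G.IsTarget w l → r w < r v := by
  induction p with
  | single h =>
    rintro v w ⟨i, rfl⟩ ⟨j, rfl⟩
    exact hr _ _ _ _
  | cons h u hu hk p ih =>
    rintro v w ⟨i, rfl⟩ hw
    obtain ⟨j, rfl⟩ := hu
    exact (ih _ _ hk hw).trans (hr _ _ _ _)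

theorem Hypergraph.IsHeight.acyclic {G : Hypergraph S} {r : G.V → ℕ} (hr : G.IsHeight r) :
    G.Acyclic :=
  fun _ _ _ p hv hw => lt_irrefl _ (hr.lt_of_path p _ _ hv hw)

/-- The height of a node is the number of nodes reachable from it by a non-empty path. It drops
along a hyperedge because the target is reachable from the source but not from itself. -/
theorem Hypergraph.Acyclic.exists_isHeight {G : Hypergraph S} (h : G.Acyclic) :
    ∃ r, G.IsHeight r := by
  refine ⟨fun v => Set.ncard {w | Relation.TransGen G.Adj v w}, fun o e i j => ?_⟩
  have he : G.Adj (G.src o e i) (G.tgt o e j) := ⟨o, e, i, j, rfl, rfl⟩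
  refine Set.ncard_lt_ncard ((Set.ssubset_iff_of_subset ?_).2 ⟨G.tgt o e j, .single he, ?_⟩)
    (Set.toFinite _)
  · intro w hw
    exact .head he hw
  · intro hw
    obtain ⟨k, l, p, hk, hl, -⟩ := exists_path_of_transGen (𝟙 G) hw
    exact h _ k l p hk hl

end Acyclic

/-! ### Rewriting steps preserve monogamy and acyclicity -/

section Gluing

/-- In a pushout of sets `f, g : RV, CV → EV` over `I ⊕ J`, where `RV` is the disjoint union of `I`
and `TR` and `CV` is the disjoint union of `J`, `X` and `TC`, while `J → RV` is arbitrary and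
`I → CV` misses `J`, the set `EV` is the disjoint union of `X`, `TR` and `TC`. -/
theorem bijective_glue {I J X TR TC RV CV EV : Type} {inp : I → RV} {out : J → RV} {tR : TR → RV}
    {c₁ : I → CV} {c₂ : J → CV} {x : X → CV} {tC : TC → CV} {f : RV → EV} {g : CV → EV}
    (hR : Function.Bijective (Sum.elim inp tR))
    (hC : Function.Bijective (Sum.elim (Sum.elim c₂ x) tC)) (hc : ∀ i j, c₁ i ≠ c₂ j)
    (hI : ∀ i, f (inp i) = g (c₁ i)) (hJ : ∀ j, f (out j) = g (c₂ j))
    (hsurj : ∀ v, (∃ r, f r = v) ∨ ∃ c, g c = v)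
    (hdesc : ∀ {Z : Type} (a : RV → Z) (b : CV → Z), (∀ i, a (inp i) = b (c₁ i)) →
      (∀ j, a (out j) = b (c₂ j)) → ∃ d : EV → Z, (∀ v, d (f v) = a v) ∧ ∀ v, d (g v) = b v) :
    Function.Bijective (Sum.elim (g ∘ x) (Sum.elim (f ∘ tR) (g ∘ tC))) := by
  have hc1 : ∀ i, (∃ y, c₁ i = x y) ∨ ∃ t, c₁ i = tC t := fun i => by
    obtain ⟨(j | y) | t, h⟩ := hC.2 (c₁ i)
    · exact (hc i j h.symm).elim
    · exact Or.inl ⟨y, h.symm⟩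
    · exact Or.inr ⟨t, h.symm⟩
  constructor
  · let eR := Equiv.ofBijective _ hR
    let eC := Equiv.ofBijective _ hC
    have heRi : ∀ i, eR.symm (inp i) = Sum.inl i := fun i => eR.symm_apply_apply (Sum.inl i)
    have heRt : ∀ t, eR.symm (tR t) = Sum.inr t := fun t => eR.symm_apply_apply (Sum.inr t)
    have heCj : ∀ j, eC.symm (c₂ j) = Sum.inl (Sum.inl j) :=
      fun j => eC.symm_apply_apply (Sum.inl (Sum.inl j))
    have heCx : ∀ y, eC.symm (x y) = Sum.inl (Sum.inr y) :=
      fun y => eC.symm_apply_apply (Sum.inl (Sum.inr y))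
    have heCt : ∀ t, eC.symm (tC t) = Sum.inr t := fun t => eC.symm_apply_apply (Sum.inr t)
    -- Descent along the pushout builds a left inverse `d` of the glued map. The value `none` of `κ`
    -- at the nodes `c₂ j` is a dummy: `κ` is only evaluated at nodes `c₁ i`, which are never of
    -- that form.
    let κ : CV → Option (X ⊕ TR ⊕ TC) := fun c =>
      Sum.elim (Sum.elim (fun _ => none) fun y => some (Sum.inl y))
        (fun t => some (Sum.inr (Sum.inr t))) (eC.symm c)
    let a : RV → Option (X ⊕ TR ⊕ TC) := fun r =>
      Sum.elim (fun i => κ (c₁ i)) (fun t => some (Sum.inr (Sum.inl t))) (eR.symm r)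
    let b : CV → Option (X ⊕ TR ⊕ TC) := fun c =>
      Sum.elim (Sum.elim (fun j => a (out j)) fun y => some (Sum.inl y))
        (fun t => some (Sum.inr (Sum.inr t))) (eC.symm c)
    obtain ⟨d, hdf, hdg⟩ := hdesc a b
      (fun i => by
        rcases hc1 i with ⟨y, hy⟩ | ⟨t, ht⟩
        · simp only [a, b, κ, heRi, hy, heCx, Sum.elim_inl, Sum.elim_inr]
        · simp only [a, b, κ, heRi, ht, heCt, Sum.elim_inl, Sum.elim_inr])
      (fun j => by simp only [b, heCj, Sum.elim_inl])
    have key : ∀ z, d (Sum.elim (g ∘ x) (Sum.elim (f ∘ tR) (g ∘ tC)) z) = some z := by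
      rintro (y | t | t)
      · simp only [Sum.elim_inl, Sum.elim_inr, Function.comp_apply, hdg, b, heCx]
      · simp only [Sum.elim_inl, Sum.elim_inr, Function.comp_apply, hdf, a, heRt]
      · simp only [Sum.elim_inr, Function.comp_apply, hdg, b, heCt]
    intro z w hzw
    exact Option.some_injective _ (by rw [← key, ← key, hzw])
  · have hg1 : ∀ i, ∃ z, Sum.elim (g ∘ x) (Sum.elim (f ∘ tR) (g ∘ tC)) z = g (c₁ i) := fun i => by
      rcases hc1 i with ⟨y, hy⟩ | ⟨t, ht⟩
      · exact ⟨Sum.inl y, by rw [hy]; rfl⟩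
      · exact ⟨Sum.inr (Sum.inr t), by rw [ht]; rfl⟩
    have hf : ∀ r, ∃ z, Sum.elim (g ∘ x) (Sum.elim (f ∘ tR) (g ∘ tC)) z = f r := fun r => by
      obtain ⟨i | t, rfl⟩ := hR.2 r
      · obtain ⟨z, hz⟩ := hg1 i
        exact ⟨z, hz.trans (hI i).symm⟩
      · exact ⟨Sum.inr (Sum.inl t), rfl⟩
    intro v
    rcases hsurj v with ⟨r, rfl⟩ | ⟨c, rfl⟩
    · exact hf r
    · obtain ⟨(j | y) | t, rfl⟩ := hC.2 c
      · obtain ⟨z, hz⟩ := hf (out j)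
        exact ⟨z, hz.trans (hJ j)⟩
      · exact ⟨Sum.inl y, rfl⟩
      · exact ⟨Sum.inr (Sum.inr t), rfl⟩

theorem bijective_ports {Op : Type} {A B C : Op → Type} (k : Op → ℕ) (f : ∀ o, A o → C o)
    (g : ∀ o, B o → C o) (h : ∀ o, Function.Bijective (Sum.elim (f o) (g o))) :
    Function.Bijective (Sum.elim
      (fun p : Σ e : (Σ o, A o), Fin (k e.1) =>
        (⟨⟨p.1.1, f _ p.1.2⟩, p.2⟩ : Σ e : (Σ o, C o), Fin (k e.1)))
      (fun p : Σ e : (Σ o, B o), Fin (k e.1) =>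
        (⟨⟨p.1.1, g _ p.1.2⟩, p.2⟩ : Σ e : (Σ o, C o), Fin (k e.1)))) := by
  constructor
  · rintro (⟨⟨o, e⟩, i⟩ | ⟨⟨o, e⟩, i⟩) (⟨⟨o', e'⟩, i'⟩ | ⟨⟨o', e'⟩, i'⟩) hpq <;>
      obtain ⟨h1, h2⟩ := Sigma.mk.inj hpq <;> obtain ⟨rfl, h3⟩ := Sigma.mk.inj h1 <;>
      replace h3 := eq_of_heq h3
    · obtain rfl : e = e' := Sum.inl_injective ((h o).1 h3)
      obtain rfl : i = i' := eq_of_heq h2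
      rfl
    · cases (h o).1 (show Sum.elim (f o) (g o) (Sum.inl e) = Sum.elim (f o) (g o) (Sum.inr e')
        from h3)
    · cases (h o).1 (show Sum.elim (f o) (g o) (Sum.inr e) = Sum.elim (f o) (g o) (Sum.inl e')
        from h3)
    · obtain rfl : e = e' := Sum.inr_injective ((h o).1 h3)
      obtain rfl : i = i' := eq_of_heq h2
      rfl
  · rintro ⟨⟨o, e⟩, i⟩
    obtain ⟨e | e, rfl⟩ := (h o).2 e
    · exact ⟨Sum.inl ⟨⟨o, e⟩, i⟩, rfl⟩
    · exact ⟨Sum.inr ⟨⟨o, e⟩, i⟩, rfl⟩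

theorem bijective_sumElim_swap {A B T V : Type} {a : A → V} {b : B → V} {t : T → V}
    (h : Function.Bijective (Sum.elim (Sum.elim a b) t)) :
    Function.Bijective (Sum.elim (Sum.elim b a) t) := by
  have := h.comp (Equiv.sumCongr (Equiv.sumComm B A) (Equiv.refl T)).bijective
  convert this using 1
  ext ((_ | _) | _) <;> rfl

variable {S : Signature} [Finite S.Op] {X Y : Type} [Finite X] [Finite Y]

/-- Both bijections for `E` come from `bijective_glue`. Only the right-hand side and the boundary
complement need to be monogamous, and the legs of the rule need not be jointly injective, as in the
unit rules where an input is also an output. -/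
theorem RuleStep.monogamous {ρ : Rule S} {D E : IHyp S X Y} (h : RuleStep ρ D E)
    (hρ : ρ.rhs.Monogamous) : E.Monogamous := by
  obtain ⟨C, c₁, c₂, d₁, d₂, -, -, f', g', -, hE, -, -, hd1, hd2, -, hc, hC⟩ := h
  obtain ⟨hR1, hR2⟩ := (IHyp.monogamous_iff _).1 hρ
  obtain ⟨hC1, hC2⟩ := (IHyp.monogamous_iff _).1 hC
  have hcinj := (mono_discrete_iff _).1 hc
  have hne : ∀ (i : Fin ρ.i) (j : Fin ρ.j), onNode c₁ i ≠ onNode c₂ j := fun i j hij => by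
    cases hcinj (show onNode (copair c₁ c₂) (Sum.inl i) = onNode (copair c₁ c₂) (Sum.inr j)
      from hij)
  have hI : ∀ i : Fin ρ.i, onNode f' (onNode ρ.rhs.inp i) = onNode g' (onNode c₁ i) :=
    fun i => pushout_node_comm hE (Sum.inl i)
  have hJ : ∀ j : Fin ρ.j, onNode f' (onNode ρ.rhs.out j) = onNode g' (onNode c₂ j) :=
    fun j => pushout_node_comm hE (Sum.inr j)
  rw [IHyp.monogamous_iff]
  constructor
  · have hg := bijective_glue hR1 hC1 hne hI hJ (pushout_node_surjective hE)
      fun a b h1 h2 => exists_desc_node hE a b (by rintro (i | j); exacts [h1 i, h2 j])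
    rw [← Function.Bijective.of_comp_iff (Sum.elim (onNode E.inp) E.G.tgtMap)
      (Equiv.sumCongr (Equiv.refl X) (Equiv.ofBijective _ (bijective_ports S.coar _ _
        (pushout_edge_bijective hE)))).bijective]
    convert hg using 1
    ext (v | ⟨⟨o, e⟩, i⟩ | ⟨⟨o, e⟩, i⟩)
    · exact congrArg (fun k : discrete S X ⟶ E.G => onNode k v) hd1.symm
    · exact (onNode_tgt f' o e i).symm
    · exact (onNode_tgt g' o e i).symm
  -- The dual statement, with inputs and outputs of the rule exchanged.
  · have hg := bijective_glue hR2 (bijective_sumElim_swap hC2) (fun j i => (hne i j).symm) hJ hI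
      (pushout_node_surjective hE)
      fun a b h1 h2 => exists_desc_node hE a b (by rintro (i | j); exacts [h2 i, h1 j])
    rw [← Function.Bijective.of_comp_iff (Sum.elim (onNode E.out) E.G.srcMap)
      (Equiv.sumCongr (Equiv.refl Y) (Equiv.ofBijective _ (bijective_ports S.ar _ _
        (pushout_edge_bijective hE)))).bijective]
    convert hg using 1
    ext (v | ⟨⟨o, e⟩, i⟩ | ⟨⟨o, e⟩, i⟩)
    · exact congrArg (fun k : discrete S Y ⟶ E.G => onNode k v) hd2.symm
    · exact (onNode_src f' o e i).symm
    · exact (onNode_src g' o e i).symm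

/-- A height function on `E` is assembled in three bands: lowest, the context nodes properly below
an output of the rule; in the middle, the nodes of the right-hand side other than its inputs; on
top, the inputs of the rule and the remaining context nodes. -/
theorem RuleStep.acyclic {ρ : Rule S} {D E : IHyp S X Y} (h : RuleStep ρ D E)
    (hρ : ρ.rhs.MonogamousAcyclic) (hD : D.G.Acyclic) : E.G.Acyclic := by
  classical
  obtain ⟨C, c₁, c₂, d₁, d₂, f, g, f', g', hDp, hE, -, -, -, -, hf, hc, hC⟩ := h
  obtain ⟨hR1, -⟩ := (IHyp.monogamous_iff _).1 hρ.monogamous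
  obtain ⟨hC1, -⟩ := (IHyp.monogamous_iff _).1 hC
  have hcinj := (mono_discrete_iff _).1 hc
  have hc1inj : Function.Injective (onNode c₁ : Fin ρ.i → C.V) :=
    fun x y hxy => Sum.inl_injective (hcinj hxy)
  have hc2inj : Function.Injective (onNode c₂ : Fin ρ.j → C.V) :=
    fun x y hxy => Sum.inr_injective (hcinj hxy)
  have hinpinj : Function.Injective (onNode ρ.rhs.inp : Fin ρ.i → ρ.rhs.G.V) :=
    fun x y hxy => Sum.inl_injective (hR1.1 hxy)
  have hne : ∀ (i : Fin ρ.i) (j : Fin ρ.j), onNode c₂ j ≠ onNode c₁ i := fun i j hij => by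
    cases hcinj (show onNode (copair c₁ c₂) (Sum.inr j) = onNode (copair c₁ c₂) (Sum.inl i)
      from hij)
  have hRt : ∀ (i : Fin ρ.i) o e j, onNode ρ.rhs.inp i ≠ ρ.rhs.G.tgt o e j := fun i o e j hij => by
    cases hR1.1 (show Sum.elim (onNode ρ.rhs.inp) ρ.rhs.G.tgtMap (Sum.inl i) =
      Sum.elim (onNode ρ.rhs.inp) ρ.rhs.G.tgtMap (Sum.inr ⟨⟨o, e⟩, j⟩) from hij)
  have hCt : ∀ (k : Fin ρ.j) o e j, onNode c₂ k ≠ C.tgt o e j := fun k o e j hij => by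
    cases hC1.1 (show Sum.elim (onNode (copair c₂ d₁)) C.tgtMap (Sum.inl (Sum.inl k)) =
      Sum.elim (onNode (copair c₂ d₁)) C.tgtMap (Sum.inr ⟨⟨o, e⟩, j⟩) from hij)
  -- A path in `C` from an output of the rule back to an input would become a path of `D` between
  -- nodes of the match. By convexity its first hyperedge would lie in the match, although it comes
  -- from `C`.
  have hconv : ∀ (i : Fin ρ.i) (j : Fin ρ.j),
      ¬ Relation.TransGen C.Adj (onNode c₂ j) (onNode c₁ i) := fun i j hij => by
    obtain ⟨h, l, p, hh, hl, o, e, rfl⟩ := exists_path_of_transGen g hij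
    have h1 : onNode f (onNode ρ.lhs.inp i) = onNode g (onNode c₁ i) :=
      pushout_node_comm hDp (Sum.inl i)
    have h2 : onNode f (onNode ρ.lhs.out j) = onNode g (onNode c₂ j) :=
      pushout_node_comm hDp (Sum.inr j)
    rw [← h1] at hl
    rw [← h2] at hh
    obtain ⟨e', he'⟩ := hf.2 _ _ _ _ p hh hl _ p.head_mem_edges
    cases (pushout_edge_bijective hDp o).1
      (show Sum.elim (onEdge f o) (onEdge g o) (Sum.inl e') =
        Sum.elim (onEdge f o) (onEdge g o) (Sum.inr e) from he')
  obtain ⟨rR, hrR⟩ := hρ.acyclic.exists_isHeight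
  obtain ⟨rC, hrC⟩ : ∃ r, C.IsHeight r := by
    obtain ⟨r, hr⟩ := hD.exists_isHeight
    exact ⟨_, hr.comp g⟩
  obtain ⟨N, hN⟩ : ∃ N, ∀ v : ρ.rhs.G.V ⊕ C.V, Sum.elim rR rC v < N := by
    obtain ⟨N, hN⟩ := (Set.finite_range (Sum.elim rR rC)).bddAbove
    exact ⟨N + 1, fun v => Nat.lt_succ_of_le (hN ⟨v, rfl⟩)⟩
  have hNR : ∀ v, rR v < N := fun v => hN (Sum.inl v)
  have hNC : ∀ v, rC v < N := fun v => hN (Sum.inr v)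
  -- Since `N` bounds both heights, the bands are below `N`, from `N` to below `2 * N`, and from `2
  -- * N` on. By `hconv` no `c₁ i` falls into the lowest band, so `a` and `b` agree on the
  -- interface.
  let a : ρ.rhs.G.V → ℕ := fun r =>
    if hr : ∃ i : Fin ρ.i, onNode ρ.rhs.inp i = r then 2 * N + rC (onNode c₁ hr.choose)
    else N + rR r
  let b : C.V → ℕ := fun c =>
    if hj : ∃ j : Fin ρ.j, onNode c₂ j = c then a (onNode ρ.rhs.out hj.choose)
    else if ∃ j : Fin ρ.j, Relation.TransGen C.Adj (onNode c₂ j) c then rC c else 2 * N + rC c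
  have ha1 : ∀ i : Fin ρ.i, a (onNode ρ.rhs.inp i) = 2 * N + rC (onNode c₁ i) := fun i => by
    have hi : ∃ k : Fin ρ.i, onNode ρ.rhs.inp k = onNode ρ.rhs.inp i := ⟨i, rfl⟩
    simp only [a, hi, dite_true]
    rw [hinpinj hi.choose_spec]
  have ha2 : ∀ r, N ≤ a r := fun r => by
    simp only [a]; split_ifs <;> omega
  have hat : ∀ o e j, a (ρ.rhs.G.tgt o e j) = N + rR (ρ.rhs.G.tgt o e j) := fun o e j => by
    simp only [a]
    rw [dif_neg fun ⟨i, hi⟩ => hRt i o e j hi]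
  have has : ∀ r, N + rR r ≤ a r := fun r => by
    have := hNR r
    simp only [a]; split_ifs <;> omega
  have hb2 : ∀ j : Fin ρ.j, b (onNode c₂ j) = a (onNode ρ.rhs.out j) := fun j => by
    have hj : ∃ k : Fin ρ.j, onNode c₂ k = onNode c₂ j := ⟨j, rfl⟩
    simp only [b, hj, dite_true]
    rw [hc2inj hj.choose_spec]
  have hb0 : ∀ c, (∃ j : Fin ρ.j, Relation.TransGen C.Adj (onNode c₂ j) c) →
      (¬ ∃ j : Fin ρ.j, onNode c₂ j = c) → b c = rC c := fun c h1 h2 => by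
    simp only [b]; rw [dif_neg h2, if_pos h1]
  have hb3 : ∀ c, (¬ ∃ j : Fin ρ.j, Relation.TransGen C.Adj (onNode c₂ j) c) →
      (¬ ∃ j : Fin ρ.j, onNode c₂ j = c) → b c = 2 * N + rC c := fun c h1 h2 => by
    simp only [b]; rw [dif_neg h2, if_neg h1]
  obtain ⟨d, hdf, hdg⟩ := exists_desc_node hE a b (by
    rintro (i | j)
    · exact (ha1 i).trans (hb3 _ (fun ⟨j, hj⟩ => hconv i j hj) fun ⟨j, hj⟩ => hne i j hj).symm
    · exact (hb2 j).symm)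
  refine Hypergraph.IsHeight.acyclic (r := d) fun o e i j => ?_
  obtain ⟨e | e, rfl⟩ := (pushout_edge_bijective hE o).2 e
  · simp only [Sum.elim_inl, ← onNode_src, ← onNode_tgt, hdf]
    rw [hat]
    have := hrR o e i j
    have := has (ρ.rhs.G.src o e i)
    omega
  · simp only [Sum.elim_inr, ← onNode_src, ← onNode_tgt, hdg]
    have ht : ¬ ∃ k : Fin ρ.j, onNode c₂ k = C.tgt o e j := fun ⟨k, hk⟩ => hCt k o e j hk
    have hadj : C.Adj (C.src o e i) (C.tgt o e j) := ⟨o, e, i, j, rfl, rfl⟩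
    have hlt := hrC o e i j
    have hlt' := hNC (C.tgt o e j)
    by_cases hs : ∃ k : Fin ρ.j, onNode c₂ k = C.src o e i
    · obtain ⟨k, hk⟩ := hs
      rw [hb0 _ ⟨k, hk ▸ .single hadj⟩ ht, ← hk, hb2]
      have := ha2 (onNode ρ.rhs.out k)
      omega
    · by_cases hs' : ∃ k : Fin ρ.j, Relation.TransGen C.Adj (onNode c₂ k) (C.src o e i)
      · rw [hb0 _ hs' hs, hb0 _ (hs'.imp fun k hk => hk.tail hadj) ht]
        exact hlt
      · rw [hb3 _ hs' hs]
        by_cases ht' : ∃ k : Fin ρ.j, Relation.TransGen C.Adj (onNode c₂ k) (C.tgt o e j)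
        · rw [hb0 _ ht' ht]
          omega
        · rw [hb3 _ ht' ht]
          omega

theorem RuleStep.monogamousAcyclic {ρ : Rule S} {D E : IHyp S X Y} (h : RuleStep ρ D E)
    (hρ : ρ.rhs.MonogamousAcyclic) (hD : D.MonogamousAcyclic) : E.MonogamousAcyclic :=
  ⟨h.monogamous hρ.monogamous, h.acyclic hρ hD.acyclic⟩

end Gluing

theorem natCard_sigma_eq_finsum {α : Type} [Finite α] (β : α → Type) [∀ a, Finite (β a)] :
    Nat.card (Σ a, β a) = ∑ᶠ a, Nat.card (β a) := by
  have := Fintype.ofFinite α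
  rw [Nat.card_sigma, finsum_eq_sum_of_fintype]

/-! ### Consequences of monogamy at single nodes -/

section Ports

variable {S : Signature} {X Y : Type} [Finite X] [Finite Y] {D : IHyp S X Y}

theorem IHyp.Monogamous.src_injective (h : D.Monogamous) : Function.Injective D.G.srcMap :=
  fun _ _ hpq => Sum.inr_injective (((IHyp.monogamous_iff D).1 h).2.1 hpq)

theorem IHyp.Monogamous.tgt_injective (h : D.Monogamous) : Function.Injective D.G.tgtMap :=
  fun _ _ hpq => Sum.inr_injective (((IHyp.monogamous_iff D).1 h).1.1 hpq)

theorem IHyp.Monogamous.out_ne_src (h : D.Monogamous) (y : Y) (o : S.Op) (e : D.G.E o)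
    (i : Fin (S.ar o)) : onNode D.out y ≠ D.G.src o e i := fun hy => by
  cases ((IHyp.monogamous_iff D).1 h).2.1 (show Sum.elim (onNode D.out) D.G.srcMap (Sum.inl y) =
    Sum.elim (onNode D.out) D.G.srcMap (Sum.inr ⟨⟨o, e⟩, i⟩) from hy)

theorem IHyp.Monogamous.output_or_src (h : D.Monogamous) (v : D.G.V) :
    (∃ y : Y, onNode D.out y = v) ∨ ∃ o e i, D.G.src o e i = v := by
  obtain ⟨y | ⟨⟨o, e⟩, i⟩, hv⟩ := ((IHyp.monogamous_iff D).1 h).2.2 v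
  · exact Or.inl ⟨y, hv⟩
  · exact Or.inr ⟨o, e, i, hv⟩

end Ports

/-! ### Paths counted recursively from their first hyperedge -/

section Suffix

variable {S : Signature}

/-- The paths starting with the hyperedge `h`, with an additional datum at their last hyperedge. -/
def Suffix (G : Hypergraph S) (Q : G.Edge → Type) (h : G.Edge) : Type :=
  Σ l, G.Path h l × Q l

/-- A path either stops at its first hyperedge or continues at a successor of it. -/
def suffixEquiv (G : Hypergraph S) (Q : G.Edge → Type) (h : G.Edge) :
    Suffix G Q h ≃ Q h ⊕ Σ x : {x : G.V × G.Edge // G.IsTarget x.1 h ∧ G.IsSource x.1 x.2},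
      Suffix G Q x.1.2 where
  toFun s := match h, s with
    | _, ⟨_, .single _, q⟩ => Sum.inl q
    | _, ⟨l, .cons _ (k := k) v hv hk p, q⟩ => Sum.inr ⟨⟨(v, k), hv, hk⟩, l, p, q⟩
  invFun s := match s with
    | .inl q => ⟨h, .single h, q⟩
    | .inr ⟨⟨(v, _), hv, hk⟩, l, p, q⟩ => ⟨l, .cons h v hv hk p, q⟩
  left_inv s := by
    obtain ⟨l, p, q⟩ := s
    cases p <;> rfl
  right_inv s := by
    rcases s with q | ⟨⟨⟨v, k⟩, hv, hk⟩, l, p, q⟩ <;> rfl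

theorem finite_suffix {G : Hypergraph S} (hG : G.Acyclic) (Q : G.Edge → Type)
    [∀ h, Finite (Q h)] (h : G.Edge) : Finite (Suffix G Q h) := by
  obtain ⟨r, hr⟩ := hG.exists_isHeight
  -- Induction on a strict bound for the heights of the targets of `h`: the targets of a successor
  -- lie below some target of `h`.
  have key : ∀ N h, (∀ v, G.IsTarget v h → r v < N) → Finite (Suffix G Q h) := by
    intro N
    induction N with
    | zero =>
      intro h hN
      have : IsEmpty {x : G.V × G.Edge // G.IsTarget x.1 h ∧ G.IsSource x.1 x.2} :=
        ⟨fun x => absurd (hN _ x.2.1) (Nat.not_lt_zero _)⟩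
      exact Finite.of_equiv _ (suffixEquiv G Q h).symm
    | succ N ih =>
      intro h hN
      have : ∀ x : {x : G.V × G.Edge // G.IsTarget x.1 h ∧ G.IsSource x.1 x.2},
          Finite (Suffix G Q x.1.2) := fun x => by
        refine ih _ ?_
        rintro w ⟨j, rfl⟩
        obtain ⟨i, hi⟩ := x.2.2
        have h1 := hN _ x.2.1
        have h2 := hr x.1.2.1 x.1.2.2 i j
        rw [hi] at h2
        omega
      exact Finite.of_equiv _ (suffixEquiv G Q h).symm
  obtain ⟨N, hN⟩ := (Set.finite_range r).bddAbove
  exact key (N + 1) h fun v _ => Nat.lt_succ_of_le (hN ⟨v, rfl⟩)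

/-- The number of paths starting at a given node. -/
noncomputable def pathsFrom (G : Hypergraph S) (Q : G.Edge → Type) (v : G.V) : ℕ :=
  Nat.card (Σ k : {k // G.IsSource v k}, Suffix G Q k.1)

variable {X Y : Type} [Finite X] [Finite Y] {D : IHyp S X Y}

/-- By monogamy a target node of `h` determines its index, so summing over continuations (node and
next hyperedge) is summing over target indices. -/
theorem IHyp.MonogamousAcyclic.card_suffix (hD : D.MonogamousAcyclic) (Q : D.G.Edge → Type)
    [∀ h, Finite (Q h)] (h : D.G.Edge) : Nat.card (Suffix D.G Q h) =
      Nat.card (Q h) + ∑ i, pathsFrom D.G Q (D.G.tgt h.1 h.2 i) := by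
  have := finite_suffix hD.acyclic Q
  let φ : (Σ i : Fin (S.coar h.1), {k // D.G.IsSource (D.G.tgt h.1 h.2 i) k}) →
      {x : D.G.V × D.G.Edge // D.G.IsTarget x.1 h ∧ D.G.IsSource x.1 x.2} :=
    fun y => ⟨(D.G.tgt h.1 h.2 y.1, y.2.1), ⟨y.1, rfl⟩, y.2.2⟩
  have hφ : Function.Bijective φ := by
    constructor
    · rintro ⟨i, k, hk⟩ ⟨j, l, hl⟩ hij
      simp only [φ, Subtype.mk.injEq, Prod.mk.injEq] at hij
      obtain ⟨hij, rfl⟩ := hij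
      have h1 := hD.monogamous.tgt_injective
        (show D.G.tgtMap ⟨h, i⟩ = D.G.tgtMap ⟨h, j⟩ from hij)
      obtain rfl : i = j := by simpa using h1
      rfl
    · rintro ⟨⟨v, k⟩, hv, hk⟩
      obtain ⟨i, hi⟩ := id hv
      exact ⟨⟨i, k, by rwa [hi]⟩, Subtype.ext (Prod.ext hi rfl)⟩
  rw [Nat.card_congr (suffixEquiv D.G Q h), Nat.card_sum,
    Nat.card_congr (Equiv.sigmaCongrLeft (Equiv.ofBijective φ hφ)).symm]
  exact congrArg _ ((Nat.card_congr (Equiv.sigmaAssoc fun i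
    (k : {k // D.G.IsSource (D.G.tgt h.1 h.2 i) k}) => Suffix D.G Q k.1)).trans Nat.card_sigma)

/-- A source node has a unique outgoing hyperedge, so paths from the node are paths starting with
that hyperedge. -/
theorem IHyp.Monogamous.pathsFrom_src (hD : D.Monogamous) (Q : D.G.Edge → Type) (o : S.Op)
    (e : D.G.E o) (i : Fin (S.ar o)) :
    pathsFrom D.G Q (D.G.src o e i) = Nat.card (Suffix D.G Q ⟨o, e⟩) := by
  let _ : Unique {k // D.G.IsSource (D.G.src o e i) k} :=
    { default := ⟨⟨o, e⟩, i, rfl⟩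
      uniq := by
        rintro ⟨⟨o', e'⟩, i', hi⟩
        have := hD.src_injective
          (show D.G.srcMap ⟨⟨o', e'⟩, i'⟩ = D.G.srcMap ⟨⟨o, e⟩, i⟩ from hi)
        exact Subtype.ext (Sigma.mk.inj this).1 }
  exact Nat.card_congr (Equiv.uniqueSigma _)

theorem IHyp.Monogamous.pathsFrom_out (hD : D.Monogamous) (Q : D.G.Edge → Type) (y : Y) :
    pathsFrom D.G Q (onNode D.out y) = 0 := by
  have : IsEmpty {k // D.G.IsSource (onNode D.out y) k} :=
    ⟨fun ⟨⟨o, e⟩, i, hi⟩ => hD.out_ne_src y o e i hi.symm⟩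
  exact Nat.card_of_isEmpty

end Suffix

section Bialgebra

/-! ## Hyperedges of bialgebra hypergraphs -/

namespace Hypergraph

variable (G : Hypergraph bialg)

/-- The `μ`-hyperedges. -/
def Mu : Type := G.E BialgOp.mu

/-- The `η`-hyperedges. -/
def Eta : Type := G.E BialgOp.eta

/-- The `δ`-hyperedges. -/
def Delta : Type := G.E BialgOp.delta

/-- The `ε`-hyperedges. -/
def Eps : Type := G.E BialgOp.eps

instance : Finite G.Mu := G.instFiniteE BialgOp.mu

instance : Finite G.Eta := G.instFiniteE BialgOp.eta

instance : Finite G.Delta := G.instFiniteE BialgOp.delta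

variable {G}

/-- A `μ`-hyperedge as a hyperedge. -/
def muEdge (e : G.Mu) : G.Edge := ⟨BialgOp.mu, e⟩

/-- An `η`-hyperedge as a hyperedge. -/
def etaEdge (e : G.Eta) : G.Edge := ⟨BialgOp.eta, e⟩

/-- A `δ`-hyperedge as a hyperedge. -/
def deltaEdge (e : G.Delta) : G.Edge := ⟨BialgOp.delta, e⟩

/-- An `ε`-hyperedge as a hyperedge. -/
def epsEdge (e : G.Eps) : G.Edge := ⟨BialgOp.eps, e⟩

/-- The sources of a `μ`-hyperedge. -/
def muSrc (e : G.Mu) (i : Fin 2) : G.V := G.src BialgOp.mu e i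

/-- The target of a `μ`-hyperedge. -/
def muTgt (e : G.Mu) : G.V := G.tgt BialgOp.mu e (0 : Fin 1)

/-- The target of an `η`-hyperedge. -/
def etaTgt (e : G.Eta) : G.V := G.tgt BialgOp.eta e (0 : Fin 1)

/-- The source of a `δ`-hyperedge. -/
def deltaSrc (e : G.Delta) : G.V := G.src BialgOp.delta e (0 : Fin 1)

/-- The targets of a `δ`-hyperedge. -/
def deltaTgt (e : G.Delta) (i : Fin 2) : G.V := G.tgt BialgOp.delta e i

/-- The source of an `ε`-hyperedge. -/
def epsSrc (e : G.Eps) : G.V := G.src BialgOp.eps e (0 : Fin 1)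

theorem sum_tgt_muEdge (φ : G.V → ℕ) (e : G.Mu) :
    ∑ i, φ (G.tgt (muEdge e).1 (muEdge e).2 i) = φ (muTgt e) :=
  Fin.sum_univ_one _

theorem sum_tgt_etaEdge (φ : G.V → ℕ) (e : G.Eta) :
    ∑ i, φ (G.tgt (etaEdge e).1 (etaEdge e).2 i) = φ (etaTgt e) :=
  Fin.sum_univ_one _

theorem sum_tgt_deltaEdge (φ : G.V → ℕ) (e : G.Delta) :
    ∑ i, φ (G.tgt (deltaEdge e).1 (deltaEdge e).2 i) = φ (deltaTgt e 0) + φ (deltaTgt e 1) :=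
  Fin.sum_univ_two _

theorem sum_tgt_epsEdge (φ : G.V → ℕ) (e : G.Eps) :
    ∑ i, φ (G.tgt (epsEdge e).1 (epsEdge e).2 i) = 0 :=
  Fin.sum_univ_zero _

end Hypergraph

open ConvexRewriting.Hypergraph

variable {X Y : Type} [Finite X] [Finite Y]

/-- The input node with a given index. -/
def IHyp.inNode {S : Signature} (D : IHyp S X Y) (x : X) : D.G.V := onNode D.inp x

/-- The output node with a given index. -/
def IHyp.outNode {S : Signature} (D : IHyp S X Y) (y : Y) : D.G.V := onNode D.out y

theorem IHyp.Monogamous.inNode_injective {S : Signature} {D : IHyp S X Y} (hD : D.Monogamous) :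
    Function.Injective D.inNode :=
  (mono_discrete_iff _).1 hD.mono_inp

/-! ## Weights -/

/-- A recipe computing numbers at the nodes of a bialgebra hypergraph, starting from the outputs:
the value at a source of a hyperedge is a function of the values at its targets. -/
structure Weight where
  base : ℕ
  mu : Fin 2 → ℕ → ℕ
  delta : ℕ → ℕ → ℕ
  eps : ℕ

/-- `p` is computed by the recipe `W` along the hyperedges of `G`. -/
structure Weight.IsFlow (W : Weight) (G : Hypergraph bialg) (p : G.V → ℕ) : Prop where
  mu : ∀ (e : G.Mu) (i : Fin 2), p (muSrc e i) = W.mu i (p (muTgt e))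
  delta : ∀ e : G.Delta, p (deltaSrc e) = W.delta (p (deltaTgt e 0)) (p (deltaTgt e 1))
  eps : ∀ e : G.Eps, p (epsSrc e) = W.eps

/-- `p` is the function on the nodes of `D` computed by the recipe `W`. -/
structure Weight.IsWeight (W : Weight) (D : IHyp bialg X Y) (p : D.G.V → ℕ) : Prop extends
    W.IsFlow D.G p where
  base : ∀ y : Y, p (D.outNode y) = W.base

/-- The number of paths to an output or an `ε`-hyperedge. -/
def Weight.u : Weight where
  base := 1
  mu _ a := a
  delta a b := a + b
  eps := 1

/-- The number of paths to a `δ`-hyperedge. -/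
def Weight.m : Weight where
  base := 0
  mu _ a := a
  delta a b := 1 + (a + b)
  eps := 0

/-- The number of first sources of `μ`-hyperedges on the descending path of `μ`-hyperedges. -/
def Weight.muChain : Weight where
  base := 0
  mu i a := if i = 0 then a + 1 else a
  delta _ _ := 0
  eps := 0

/-- The size of the `δ`-tree. -/
def Weight.deltaTree : Weight where
  base := 0
  mu _ _ := 0
  delta a b := 1 + (a + b)
  eps := 0

variable {D : IHyp bialg X Y}

theorem IHyp.Monogamous.pathsFrom_muSrc (hD : D.Monogamous) (Q : D.G.Edge → Type) (e : D.G.Mu)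
    (i : Fin 2) : pathsFrom D.G Q (muSrc e i) = Nat.card (Suffix D.G Q (muEdge e)) :=
  hD.pathsFrom_src Q BialgOp.mu e i

theorem IHyp.Monogamous.pathsFrom_deltaSrc (hD : D.Monogamous) (Q : D.G.Edge → Type)
    (e : D.G.Delta) : pathsFrom D.G Q (deltaSrc e) = Nat.card (Suffix D.G Q (deltaEdge e)) :=
  hD.pathsFrom_src Q BialgOp.delta e (0 : Fin 1)

theorem IHyp.Monogamous.pathsFrom_epsSrc (hD : D.Monogamous) (Q : D.G.Edge → Type)
    (e : D.G.Eps) : pathsFrom D.G Q (epsSrc e) = Nat.card (Suffix D.G Q (epsEdge e)) :=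
  hD.pathsFrom_src Q BialgOp.eps e (0 : Fin 1)

theorem natCard_pLift_of_not {p : Prop} (h : ¬ p) : Nat.card (PLift p) = 0 := by
  have : IsEmpty (PLift p) := ⟨fun q => h q.down⟩
  exact Nat.card_of_isEmpty

theorem natCard_pLift_of {p : Prop} (h : p) : Nat.card (PLift p) = 1 :=
  Nat.card_eq_one_iff_unique.2 ⟨⟨fun ⟨_⟩ ⟨_⟩ => rfl⟩, ⟨⟨h⟩⟩⟩

/-! ### Numbers of U-paths and M-paths as sums of node weights -/

section Counting

variable {n m : ℕ} {D : IHyp bialg (Fin n) (Fin m)}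

/-- The hyperedge `h` is labelled by `δ`. -/
def Hypergraph.IsDelta {G : Hypergraph bialg} (h : G.Edge) : Prop := h.1 = BialgOp.delta

/-- The hyperedge `h` is labelled by `ε`. -/
def Hypergraph.IsEps {G : Hypergraph bialg} (h : G.Edge) : Prop := h.1 = BialgOp.eps

/-- An M-path is a `μ`-hyperedge together with a path continuing from its target to a `δ`. At a
source of a `δ`, the summand 1 is the path stopping there. -/
theorem exists_weight_m (hD : D.MonogamousAcyclic) : Finite (MPath D) ∧
    ∃ p, Weight.m.IsWeight D p ∧ Nat.card (MPath D) = ∑ᶠ e : D.G.Mu, p (muTgt e) := by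
  let Q : D.G.Edge → Type := fun h => PLift (IsDelta h)
  have hQ : ∀ h, Finite (Q h) := fun h => inferInstanceAs (Finite (PLift _))
  have := finite_suffix hD.acyclic Q
  let φ : MPath D ≃ Σ e : D.G.Mu, Suffix D.G Q (muEdge e) :=
    { toFun := fun P => ⟨P.first, deltaEdge P.last, P.path, ⟨rfl⟩⟩
      invFun := fun P => match P with
        | ⟨e, ⟨_, l⟩, p, ⟨rfl⟩⟩ => ⟨e, l, p⟩
      left_inv := fun _ => rfl
      right_inv := by
        rintro ⟨e, ⟨_, l⟩, p, ⟨⟨⟩⟩⟩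
        rfl }
  have hmu : ∀ e : D.G.Mu, Nat.card (Suffix D.G Q (muEdge e)) = pathsFrom D.G Q (muTgt e) :=
    fun e => by
      rw [hD.card_suffix, natCard_pLift_of_not (fun h => by cases h), zero_add, sum_tgt_muEdge]
  refine ⟨Finite.of_equiv _ φ.symm, pathsFrom D.G Q, ⟨⟨?_, ?_, ?_⟩, ?_⟩, ?_⟩
  · intro e i
    exact (hD.monogamous.pathsFrom_muSrc Q e i).trans (hmu e)
  · intro e
    rw [hD.monogamous.pathsFrom_deltaSrc, hD.card_suffix,
      natCard_pLift_of (show IsDelta (deltaEdge e) from rfl), sum_tgt_deltaEdge]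
    rfl
  · intro e
    rw [hD.monogamous.pathsFrom_epsSrc, hD.card_suffix,
      natCard_pLift_of_not (fun h => by cases h), zero_add, sum_tgt_epsEdge]
    rfl
  · exact hD.monogamous.pathsFrom_out Q
  · rw [Nat.card_congr φ, natCard_sigma_eq_finsum]
    exact finsum_congr hmu

-- The weight at an output is 1, counting the empty path, while U-paths contain at least one
-- hyperedge. The correction on the left accounts for the bare wires, inputs that are also outputs,
-- whose weight corresponds to no U-path.
open Classical in
theorem exists_weight_u (hD : D.MonogamousAcyclic) : Finite (UPath D) ∧
    ∃ p, Weight.u.IsWeight D p ∧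
      Nat.card (UPath D) + ∑ x : Fin n, (if D.IsOutput (D.inNode x) then 1 else 0) =
        ∑ x : Fin n, p (D.inNode x) + ∑ᶠ e : D.G.Eta, p (etaTgt e) := by
  let Q : D.G.Edge → Type := fun h =>
    {v : D.G.V // D.IsOutput v ∧ D.G.IsTarget v h} ⊕ PLift (IsEps h)
  have hQ : ∀ h, Finite (Q h) := fun h => inferInstanceAs (Finite (_ ⊕ PLift _))
  have := finite_suffix hD.acyclic Q
  let ψ : ((Σ x : Fin n, Σ k : {k // D.G.IsSource (D.inNode x) k}, Suffix D.G Q k.1) ⊕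
      Σ e : D.G.Eta, Suffix D.G Q (etaEdge e)) → UPath D := fun s => match s with
    | .inl ⟨x, k, l, p, q⟩ => ⟨k.1, l, p, .inl ⟨D.inNode x, ⟨x, rfl⟩, k.2⟩, q⟩
    | .inr ⟨e, l, p, q⟩ => ⟨etaEdge e, l, p, .inr ⟨rfl⟩, q⟩
  have hψ : Function.Bijective ψ := by
    constructor
    · rintro (⟨x, ⟨k, hk⟩, l, p, q⟩ | ⟨e, l, p, q⟩) (⟨x', ⟨k', hk'⟩, l', p', q'⟩ | ⟨e', l', p', q'⟩) h
      · obtain ⟨rfl, rfl, h3, h4, h5⟩ := UPath.mk.inj h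
        obtain rfl := eq_of_heq h3
        obtain rfl := eq_of_heq h5
        have hx : D.inNode x = D.inNode x' :=
          congrArg Subtype.val (Sum.inl_injective (eq_of_heq h4))
        obtain rfl : x = x' := hD.monogamous.inNode_injective hx
        rfl
      · obtain ⟨rfl, rfl, h3, h4, h5⟩ := UPath.mk.inj h
        cases eq_of_heq h4
      · obtain ⟨rfl, rfl, h3, h4, h5⟩ := UPath.mk.inj h
        cases eq_of_heq h4
      · obtain ⟨h1, rfl, h3, h4, h5⟩ := UPath.mk.inj h
        obtain rfl : e = e' := eq_of_heq (Sigma.mk.inj h1).2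
        obtain rfl := eq_of_heq h3
        obtain rfl := eq_of_heq h5
        rfl
    · rintro ⟨⟨o, e⟩, l, p, ⟨v, ⟨x, rfl⟩, hk⟩ | h, q⟩
      · exact ⟨.inl ⟨x, ⟨_, hk⟩, l, p, q⟩, rfl⟩
      · obtain rfl : o = (BialgOp.eta : bialg.Op) := h.down
        exact ⟨.inr ⟨e, l, p, q⟩, rfl⟩
  -- The weight will be `b + pathsFrom`: `b` contributes the empty path at an output, and so records
  -- the paths that end on reaching that node.
  let b : D.G.V → ℕ := fun v => if D.IsOutput v then 1 else 0
  have hcard : ∀ h, Nat.card (Suffix D.G Q h) = Nat.card (PLift (IsEps h)) +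
      ∑ i, (b (D.G.tgt h.1 h.2 i) + pathsFrom D.G Q (D.G.tgt h.1 h.2 i)) := fun h => by
    let τ : {i // D.IsOutput (D.G.tgt h.1 h.2 i)} →
        {v : D.G.V // D.IsOutput v ∧ D.G.IsTarget v h} :=
      fun i => ⟨D.G.tgt h.1 h.2 i.1, i.2, i.1, rfl⟩
    have hτ : Function.Bijective τ := by
      constructor
      · intro i j hij
        have h1 := hD.monogamous.tgt_injective
          (show D.G.tgtMap ⟨h, i.1⟩ = D.G.tgtMap ⟨h, j.1⟩ from congrArg Subtype.val hij)
        exact Subtype.ext (by simpa using h1)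
      · rintro ⟨v, hv, i, rfl⟩
        exact ⟨⟨i, hv⟩, rfl⟩
    rw [hD.card_suffix Q h, Nat.card_sum, ← Nat.card_congr (Equiv.ofBijective τ hτ),
      Finset.sum_add_distrib, Nat.card_eq_fintype_card (α := {i // D.IsOutput _}),
      Fintype.card_subtype, Finset.card_filter]
    simp only [b]
    ring
  have hb : ∀ o e i, b (D.G.src o e i) = 0 := fun o e i =>
    if_neg fun ⟨y, hy⟩ => hD.monogamous.out_ne_src y o e i hy
  refine ⟨Finite.of_surjective _ hψ.2, fun v => b v + pathsFrom D.G Q v,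
    ⟨⟨?_, ?_, ?_⟩, ?_⟩, ?_⟩
  · intro e i
    have h0 : b (muSrc e i) = 0 := hb _ _ _
    rw [h0, hD.monogamous.pathsFrom_muSrc, hcard, natCard_pLift_of_not (fun h => by cases h),
      zero_add, zero_add, sum_tgt_muEdge fun v => b v + pathsFrom D.G Q v]
    rfl
  · intro e
    have h0 : b (deltaSrc e) = 0 := hb _ _ _
    rw [h0, hD.monogamous.pathsFrom_deltaSrc, hcard, natCard_pLift_of_not (fun h => by cases h),
      zero_add, zero_add, sum_tgt_deltaEdge fun v => b v + pathsFrom D.G Q v]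
    rfl
  · intro e
    have h0 : b (epsSrc e) = 0 := hb _ _ _
    rw [h0, hD.monogamous.pathsFrom_epsSrc, hcard,
      natCard_pLift_of (show IsEps (epsEdge e) from rfl),
      zero_add, sum_tgt_epsEdge fun v => b v + pathsFrom D.G Q v]
    rfl
  · intro y
    have h0 : b (D.outNode y) = 1 := if_pos ⟨y, rfl⟩
    have h1 : pathsFrom D.G Q (D.outNode y) = 0 := hD.monogamous.pathsFrom_out Q y
    rw [h0, h1]
    rfl
  · rw [← Nat.card_congr (Equiv.ofBijective ψ hψ), Nat.card_sum,
      natCard_sigma_eq_finsum (α := D.G.Eta), Nat.card_sigma, Finset.sum_add_distrib]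
    have : ∀ e : D.G.Eta, Nat.card (Suffix D.G Q (etaEdge e)) =
        b (etaTgt e) + pathsFrom D.G Q (etaTgt e) := fun e => by
      rw [hcard, natCard_pLift_of_not (fun h => by cases h), zero_add,
        sum_tgt_etaEdge fun v => b v + pathsFrom D.G Q v]
    simp only [this]
    simp only [b, pathsFrom]
    ring

end Counting

end Bialgebra

open ConvexRewriting.Hypergraph

/-! ### The L-weight as a sum of node weights -/

section LWeight

variable {X Y : Type} [Finite X] [Finite Y] {D : IHyp bialg X Y}

theorem IHyp.Monogamous.muSrc_injective (hD : D.Monogamous) {e e' : D.G.Mu} {i i' : Fin 2}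
    (h : muSrc e i = muSrc e' i') : e = e' ∧ i = i' := by
  have h1 := hD.src_injective
    (show D.G.srcMap ⟨muEdge e, i⟩ = D.G.srcMap ⟨muEdge e', i'⟩ from h)
  obtain ⟨h2, h3⟩ := Sigma.mk.inj h1
  obtain rfl : e = e' := eq_of_heq (Sigma.mk.inj h2).2
  exact ⟨rfl, eq_of_heq h3⟩

theorem IHyp.Monogamous.deltaSrc_injective (hD : D.Monogamous) {e e' : D.G.Delta}
    (h : deltaSrc e = deltaSrc e') : e = e' := by
  have h1 := hD.src_injective
    (show D.G.srcMap ⟨deltaEdge e, (0 : Fin 1)⟩ = D.G.srcMap ⟨deltaEdge e', (0 : Fin 1)⟩ from h)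
  exact eq_of_heq (Sigma.mk.inj (Sigma.mk.inj h1).1).2

theorem IHyp.Monogamous.deltaTgt_injective (hD : D.Monogamous) {e e' : D.G.Delta} {i i' : Fin 2}
    (h : deltaTgt e i = deltaTgt e' i') : e = e' ∧ i = i' := by
  have h1 := hD.tgt_injective
    (show D.G.tgtMap ⟨deltaEdge e, i⟩ = D.G.tgtMap ⟨deltaEdge e', i'⟩ from h)
  obtain ⟨h2, h3⟩ := Sigma.mk.inj h1
  obtain rfl : e = e' := eq_of_heq (Sigma.mk.inj h2).2
  exact ⟨rfl, eq_of_heq h3⟩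

theorem IHyp.Monogamous.deltaSrc_ne_muSrc (hD : D.Monogamous) (e : D.G.Delta) (e' : D.G.Mu)
    (i : Fin 2) : deltaSrc e ≠ muSrc e' i := fun h => by
  have h1 := hD.src_injective
    (show D.G.srcMap ⟨deltaEdge e, (0 : Fin 1)⟩ = D.G.srcMap ⟨muEdge e', i⟩ from h)
  cases (Sigma.mk.inj (Sigma.mk.inj h1).1).1

theorem IHyp.Monogamous.epsSrc_ne_muSrc (hD : D.Monogamous) (e : D.G.Eps) (e' : D.G.Mu)
    (i : Fin 2) : epsSrc e ≠ muSrc e' i := fun h => by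
  have h1 := hD.src_injective
    (show D.G.srcMap ⟨epsEdge e, (0 : Fin 1)⟩ = D.G.srcMap ⟨muEdge e', i⟩ from h)
  cases (Sigma.mk.inj (Sigma.mk.inj h1).1).1

theorem IHyp.Monogamous.epsSrc_ne_deltaSrc (hD : D.Monogamous) (e : D.G.Eps) (e' : D.G.Delta) :
    epsSrc e ≠ deltaSrc e' := fun h => by
  have h1 := hD.src_injective
    (show D.G.srcMap ⟨epsEdge e, (0 : Fin 1)⟩ = D.G.srcMap ⟨deltaEdge e', (0 : Fin 1)⟩ from h)
  cases (Sigma.mk.inj (Sigma.mk.inj h1).1).1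

theorem IHyp.Monogamous.outNode_ne_muSrc (hD : D.Monogamous) (y : Y) (e : D.G.Mu) (i : Fin 2) :
    D.outNode y ≠ muSrc e i :=
  hD.out_ne_src y BialgOp.mu e i

theorem IHyp.Monogamous.outNode_ne_deltaSrc (hD : D.Monogamous) (y : Y) (e : D.G.Delta) :
    D.outNode y ≠ deltaSrc e :=
  hD.out_ne_src y BialgOp.delta e (0 : Fin 1)

theorem Hypergraph.IsHeight.mu_lt {G : Hypergraph bialg} {r : G.V → ℕ} (hr : G.IsHeight r)
    (e : G.Mu) (i : Fin 2) : r (muTgt e) < r (muSrc e i) :=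
  hr BialgOp.mu e i (0 : Fin 1)

theorem Hypergraph.IsHeight.delta_lt {G : Hypergraph bialg} {r : G.V → ℕ} (hr : G.IsHeight r)
    (e : G.Delta) (i : Fin 2) : r (deltaTgt e i) < r (deltaSrc e) :=
  hr BialgOp.delta e (0 : Fin 1) i

/-- The hyperedge `h` belongs to the `μ`-tree with root `x`. -/
def Hypergraph.MuTree {G : Hypergraph bialg} (x : G.V) (h : G.Mu) : Prop := InMuTree G x h

/-- The hyperedge `h` belongs to the `δ`-tree with root `x`. -/
def Hypergraph.DeltaTree {G : Hypergraph bialg} (x : G.V) (h : G.Delta) : Prop :=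
  InDeltaTree G x h

theorem muTree_iff {G : Hypergraph bialg} {x : G.V} {k : G.Mu} :
    MuTree x k ↔ muTgt k = x ∨ ∃ h i, MuTree x h ∧ muTgt k = muSrc h i := by
  constructor
  · intro h
    cases h with
    | root h hx => exact Or.inl hx
    | child h k i hh hk => exact Or.inr ⟨h, i, hh, hk⟩
  · rintro (h | ⟨h, i, hh, hk⟩)
    · exact .root k h
    · exact .child h k i hh hk

theorem deltaTree_iff {G : Hypergraph bialg} {x : G.V} {k : G.Delta} :
    DeltaTree x k ↔ deltaSrc k = x ∨ ∃ h i, DeltaTree x h ∧ deltaSrc k = deltaTgt h i := by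
  constructor
  · intro h
    cases h with
    | root h hx => exact Or.inl hx
    | child h k i hh hk => exact Or.inr ⟨h, i, hh, hk⟩
  · rintro (h | ⟨h, i, hh, hk⟩)
    · exact .root k h
    · exact .child h k i hh hk

theorem deltaTree_induction {G : Hypergraph bialg} {x : G.V} {P : G.Delta → Prop}
    (root : ∀ h, deltaSrc h = x → P h)
    (child : ∀ h k i, DeltaTree x h → deltaSrc k = deltaTgt h i → P h → P k) :
    ∀ {k}, DeltaTree x k → P k := by
  intro k h
  induction h with
  | root h hx => exact root h hx
  | child h k i hh hk ih => exact child h k i hh hk ih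

theorem Hypergraph.IsHeight.muTree_le {G : Hypergraph bialg} {r : G.V → ℕ} (hr : G.IsHeight r)
    {x : G.V} {k : G.Mu} (h : MuTree x k) : r x ≤ r (muTgt k) := by
  induction h with
  | root h hx => exact hx ▸ le_rfl
  | child h k i hh hk ih =>
    have h1 : muTgt k = muSrc h i := hk
    rw [h1]
    exact ih.trans (hr.mu_lt h i).le

theorem Hypergraph.IsHeight.deltaTree_le {G : Hypergraph bialg} {r : G.V → ℕ} (hr : G.IsHeight r)
    {x : G.V} {k : G.Delta} (h : DeltaTree x k) : r (deltaSrc k) ≤ r x := by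
  refine deltaTree_induction (P := fun k => r (deltaSrc k) ≤ r x) ?_ ?_ h
  · rintro h rfl
    exact le_rfl
  · intro h k i _ hk ih
    rw [hk]
    exact (hr.delta_lt h i).le.trans ih

/-- The `μ`-hyperedges whose first source is reached from `v` by descending through
`μ`-hyperedges. -/
def muChainSet (G : Hypergraph bialg) (v : G.V) : Set G.Mu :=
  {h | v = muSrc h 0 ∨ ∃ k i, MuTree (muSrc h 0) k ∧ v = muSrc k i}

theorem mem_muChainSet_muTgt {G : Hypergraph bialg} {h k : G.Mu} :
    h ∈ muChainSet G (muTgt k) ↔ MuTree (muSrc h 0) k :=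
  muTree_iff.symm

/-- Passing from the target of `e` to its source `i` lengthens the descending chain by that one
source, which counts only when `i = 0`. Acyclicity ensures that `e` was not counted already. -/
theorem isWeight_muChain (hD : D.MonogamousAcyclic) :
    Weight.muChain.IsWeight D fun v => (muChainSet D.G v).ncard := by
  obtain ⟨r, hr⟩ := hD.acyclic.exists_isHeight
  have hM := hD.monogamous
  have empty : ∀ v, (∀ (e : D.G.Mu) i, v ≠ muSrc e i) → (muChainSet D.G v).ncard = 0 := by
    intro v hv
    rw [Set.ncard_eq_zero]
    ext h
    simp only [Set.mem_empty_iff_false, iff_false]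
    rintro (h1 | ⟨k, i, -, h1⟩)
    · exact hv _ _ h1
    · exact hv _ _ h1
  refine ⟨⟨?_, fun e => empty _ (hM.deltaSrc_ne_muSrc e), fun e => empty _ (hM.epsSrc_ne_muSrc e)⟩,
    fun y => empty _ (hM.outNode_ne_muSrc y)⟩
  intro e i
  have hmem : ∀ h, h ∈ muChainSet D.G (muSrc e i) ↔
      (h = e ∧ i = 0) ∨ h ∈ muChainSet D.G (muTgt e) := by
    intro h
    rw [mem_muChainSet_muTgt]
    constructor
    · rintro (h1 | ⟨k, j, hk, h1⟩)
      · obtain ⟨rfl, rfl⟩ := hM.muSrc_injective h1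
        exact Or.inl ⟨rfl, rfl⟩
      · obtain ⟨rfl, rfl⟩ := hM.muSrc_injective h1
        exact Or.inr hk
    · rintro (⟨rfl, rfl⟩ | h1)
      · exact Or.inl rfl
      · exact Or.inr ⟨e, i, h1, rfl⟩
  have hnot : e ∉ muChainSet D.G (muTgt e) := fun h => by
    have h1 := hr.muTree_le (mem_muChainSet_muTgt.1 h)
    have h2 := hr.mu_lt e 0
    omega
  by_cases hi : i = 0
  · have : muChainSet D.G (muSrc e i) = insert e (muChainSet D.G (muTgt e)) := by
      ext h
      rw [hmem, Set.mem_insert_iff]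
      simp only [hi, and_true]
    change (muChainSet D.G (muSrc e i)).ncard = if i = 0 then _ else _
    rw [this, Set.ncard_insert_of_notMem hnot, if_pos hi]
  · have : muChainSet D.G (muSrc e i) = muChainSet D.G (muTgt e) := by
      ext h
      rw [hmem]
      simp only [hi, and_false, false_or]
    change (muChainSet D.G (muSrc e i)).ncard = if i = 0 then _ else _
    rw [this, if_neg hi]

/-- Every node is a target of at most one hyperedge, so the ancestors of `k` among `δ`-hyperedges
form a chain, and two roots above `k` both lie on it. -/
theorem IHyp.Monogamous.deltaTree_comparable (hD : D.Monogamous) {x y : D.G.V} {k : D.G.Delta}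
    (hx : DeltaTree x k) : DeltaTree y k → x = y ∨
      (∃ h i, DeltaTree x h ∧ deltaTgt h i = y) ∨ ∃ h i, DeltaTree y h ∧ deltaTgt h i = x := by
  refine deltaTree_induction (P := fun k => DeltaTree y k → x = y ∨
      (∃ h i, DeltaTree x h ∧ deltaTgt h i = y) ∨ ∃ h i, DeltaTree y h ∧ deltaTgt h i = x) ?_ ?_ hx
  · rintro h rfl hy
    rcases deltaTree_iff.1 hy with h1 | ⟨h', i, h1, h2⟩
    · exact Or.inl h1
    · exact Or.inr (Or.inr ⟨h', i, h1, h2.symm⟩)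
  · intro h k i hh hk ih hy
    rcases deltaTree_iff.1 hy with h1 | ⟨h', i', h1, h2⟩
    · exact Or.inr (Or.inl ⟨h, i, hh, hk.symm.trans h1⟩)
    · obtain ⟨rfl, -⟩ := hD.deltaTgt_injective (hk.symm.trans h2)
      exact ih h1

/-- The tree rooted at the source of `e` is `e` together with the trees at its two targets. -/
theorem isWeight_deltaTree (hD : D.MonogamousAcyclic) :
    Weight.deltaTree.IsWeight D fun v => {k : D.G.Delta | DeltaTree v k}.ncard := by
  obtain ⟨r, hr⟩ := hD.acyclic.exists_isHeight
  have hM := hD.monogamous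
  have empty : ∀ v, (∀ e : D.G.Delta, deltaSrc e ≠ v) →
      {k : D.G.Delta | DeltaTree v k}.ncard = 0 := by
    intro v hv
    rw [Set.ncard_eq_zero]
    ext h
    simp only [Set.mem_empty_iff_false, iff_false]
    intro hh
    exact deltaTree_induction (P := fun _ => False) (fun h hx => hv h hx)
      (fun _ _ _ _ _ ih => ih) hh
  refine ⟨⟨fun e i => empty _ fun d h => hM.deltaSrc_ne_muSrc d e i h, ?_,
    fun e => empty _ fun d h => hM.epsSrc_ne_deltaSrc e d h.symm⟩,
    fun y => empty _ fun d h => hM.outNode_ne_deltaSrc y d h.symm⟩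
  intro e
  have hset : {k : D.G.Delta | DeltaTree (deltaSrc e) k} = insert e
      ({k | DeltaTree (deltaTgt e 0) k} ∪ {k | DeltaTree (deltaTgt e 1) k}) := by
    ext k
    simp only [Set.mem_ofPred_eq, Set.mem_insert_iff, Set.mem_union]
    constructor
    · refine deltaTree_induction (P := fun k => k = e ∨ DeltaTree (deltaTgt e 0) k ∨
        DeltaTree (deltaTgt e 1) k) (fun h hx => Or.inl (hM.deltaSrc_injective hx)) ?_
      rintro h k i - hk (rfl | h1 | h1)
      · refine Or.inr ?_
        fin_cases i
        · exact Or.inl (deltaTree_iff.2 (Or.inl hk))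
        · exact Or.inr (deltaTree_iff.2 (Or.inl hk))
      · exact Or.inr (Or.inl (deltaTree_iff.2 (Or.inr ⟨h, i, h1, hk⟩)))
      · exact Or.inr (Or.inr (deltaTree_iff.2 (Or.inr ⟨h, i, h1, hk⟩)))
    · have hroot : DeltaTree (deltaSrc e) e := deltaTree_iff.2 (Or.inl rfl)
      have hchild : ∀ i, DeltaTree (deltaTgt e i) k → DeltaTree (deltaSrc e) k := by
        intro i
        refine deltaTree_induction (P := fun k => DeltaTree (deltaSrc e) k) ?_ ?_
        · intro h hx
          exact deltaTree_iff.2 (Or.inr ⟨e, i, hroot, hx⟩)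
        · intro h k j _ hk ih
          exact deltaTree_iff.2 (Or.inr ⟨h, j, ih, hk⟩)
      rintro (rfl | h | h)
      · exact hroot
      · exact hchild 0 h
      · exact hchild 1 h
  have hnot : ∀ i, ¬ DeltaTree (deltaTgt e i) e := fun i h => by
    have h1 := hr.deltaTree_le h
    have h2 := hr.delta_lt e i
    omega
  -- If the subtrees met, their roots would be comparable. Then the two targets would coincide, or
  -- one would be a target of a hyperedge in the other's subtree; that hyperedge is `e` itself,
  -- which acyclicity excludes.
  have hdisj : Disjoint {k | DeltaTree (deltaTgt e 0) k} {k | DeltaTree (deltaTgt e 1) k} := by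
    rw [Set.disjoint_left]
    intro k h0 h1
    rcases hM.deltaTree_comparable h0 h1 with h | ⟨h, i, h2, h3⟩ | ⟨h, i, h2, h3⟩
    · exact absurd (hM.deltaTgt_injective h).2 (by decide)
    · obtain ⟨rfl, -⟩ := hM.deltaTgt_injective h3
      exact hnot _ h2
    · obtain ⟨rfl, -⟩ := hM.deltaTgt_injective h3
      exact hnot _ h2
  rw [hset, Set.ncard_insert_of_notMem (by rintro (h | h); exacts [hnot _ h, hnot _ h]),
    Set.ncard_union_eq hdisj, add_comm]
  rfl

/-- The `δ`-part already has the required form. In the `μ`-part the pairs of `h` and a member `k` of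
the tree at its first source are counted by `k` instead of by `h`. -/
theorem lWeight_eq (hD : D.MonogamousAcyclic) :
    ∃ p q, Weight.muChain.IsWeight D p ∧ Weight.deltaTree.IsWeight D q ∧
      LWeight D.G = ∑ᶠ e : D.G.Mu, p (muTgt e) + ∑ᶠ e : D.G.Delta, q (deltaTgt e 0) := by
  refine ⟨_, _, isWeight_muChain hD, isWeight_deltaTree hD, congrArg₂ _ ?_ rfl⟩
  have h1 : (∑ᶠ h : D.G.Mu, Nat.card {k : D.G.Mu // MuTree (muSrc h 0) k}) =
      ∑ᶠ k : D.G.Mu, Nat.card {h : D.G.Mu // MuTree (muSrc h 0) k} := by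
    rw [← natCard_sigma_eq_finsum, ← natCard_sigma_eq_finsum]
    exact Nat.card_congr
      { toFun := fun s => ⟨s.2.1, s.1, s.2.2⟩
        invFun := fun s => ⟨s.2.1, s.1, s.2.2⟩
        left_inv := fun _ => rfl
        right_inv := fun _ => rfl }
  refine Eq.trans h1 (finsum_congr fun k => ?_)
  rw [← Nat.card_coe_set_eq]
  exact Nat.card_congr (Equiv.subtypeEquivRight fun h => mem_muChainSet_muTgt.symm)

end LWeight

/-! ### Comparing node weights before and after a step -/

section Transfer

theorem finsum_sumElim {A B T : Type} [Finite A] [Finite B] {a : A → T} {b : B → T}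
    (h : Function.Bijective (Sum.elim a b)) (φ : T → ℕ) :
    ∑ᶠ t, φ t = ∑ᶠ x, φ (a x) + ∑ᶠ y, φ (b y) := by
  have := Fintype.ofFinite A
  have := Fintype.ofFinite B
  rw [finsum_eq_sum_of_fintype (fun x => φ (a x)), finsum_eq_sum_of_fintype (fun x => φ (b x)),
    ← finsum_comp_equiv (Equiv.ofBijective _ h), finsum_eq_sum_of_fintype, Fintype.sum_sum_type]
  rfl

theorem natCard_sumElim {A B T : Type} [Finite A] [Finite B] {a : A → T} {b : B → T}
    (h : Function.Bijective (Sum.elim a b)) : Nat.card T = Nat.card A + Nat.card B := by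
  rw [← Nat.card_congr (Equiv.ofBijective _ h), Nat.card_sum]

theorem finsum_le_finsum_of_finite {A : Type} [Finite A] {φ ψ : A → ℕ} (h : ∀ a, φ a ≤ ψ a) :
    ∑ᶠ a, φ a ≤ ∑ᶠ a, ψ a := by
  have := Fintype.ofFinite A
  rw [finsum_eq_sum_of_fintype, finsum_eq_sum_of_fintype]
  exact Finset.sum_le_sum fun a _ => h a

theorem finsum_lt_finsum_of_finite {A : Type} [Finite A] {φ ψ : A → ℕ} (h : ∀ a, φ a ≤ ψ a)
    (a : A) (ha : φ a < ψ a) : ∑ᶠ a, φ a < ∑ᶠ a, ψ a := by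
  have := Fintype.ofFinite A
  rw [finsum_eq_sum_of_fintype, finsum_eq_sum_of_fintype]
  exact Finset.sum_lt_sum (fun a _ => h a) ⟨a, Finset.mem_univ a, ha⟩

variable {X Y : Type} [Finite X] [Finite Y]

/-- The combinatorial content of a rewriting step from `D` to `E` by the rule `ρ` with context `C`:
the nodes and hyperedges of `D` and `E` in terms of those of `C` and of the two sides of `ρ`. -/
structure Decomposition {S : Signature} (ρ : Rule S) (D E : IHyp S X Y) (C : Hypergraph S)
    (f : ρ.lhs.G ⟶ D.G) (g : C ⟶ D.G) (f' : ρ.rhs.G ⟶ E.G) (g' : C ⟶ E.G)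
    (c₁ : Fin ρ.i → C.V) (c₂ : Fin ρ.j → C.V) (d₁ : X → C.V) (d₂ : Y → C.V) : Prop where
  lhs_in : ∀ i, onNode f (ρ.lhs.inNode i) = onNode g (c₁ i)
  lhs_out : ∀ j, onNode f (ρ.lhs.outNode j) = onNode g (c₂ j)
  rhs_in : ∀ i, onNode f' (ρ.rhs.inNode i) = onNode g' (c₁ i)
  rhs_out : ∀ j, onNode f' (ρ.rhs.outNode j) = onNode g' (c₂ j)
  in_left : ∀ x, onNode g (d₁ x) = D.inNode x
  out_left : ∀ y, onNode g (d₂ y) = D.outNode y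
  in_right : ∀ x, onNode g' (d₁ x) = E.inNode x
  out_right : ∀ y, onNode g' (d₂ y) = E.outNode y
  edge_left : ∀ o, Function.Bijective (Sum.elim (onEdge f o) (onEdge g o))
  edge_right : ∀ o, Function.Bijective (Sum.elim (onEdge f' o) (onEdge g' o))
  cases_tgt : ∀ c, (∃ j, c₂ j = c) ∨ (∃ x, d₁ x = c) ∨ ∃ o e i, C.tgt o e i = c
  cases_src : ∀ c, (∃ y, d₂ y = c) ∨ (∃ i, c₁ i = c) ∨ ∃ o e i, C.src o e i = c
  injective : Function.Injective (Sum.elim ρ.lhs.inNode ρ.lhs.outNode) →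
    Function.Injective (onNode g)

theorem RuleStep.exists_decomposition {S : Signature} [Finite S.Op] {ρ : Rule S}
    {D E : IHyp S X Y} (h : RuleStep ρ D E) :
    ∃ C f g f' g' c₁ c₂ d₁ d₂, Decomposition ρ D E C f g f' g' c₁ c₂ d₁ d₂ := by
  obtain ⟨C, c₁, c₂, d₁, d₂, f, g, f', g', hD, hE, h1, h2, h3, h4, -, -, hC⟩ := h
  obtain ⟨hC1, hC2⟩ := (IHyp.monogamous_iff _).1 hC
  refine ⟨C, f, g, f', g', onNode c₁, onNode c₂, onNode d₁, onNode d₂,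
    fun i => pushout_node_comm hD (Sum.inl i), fun j => pushout_node_comm hD (Sum.inr j),
    fun i => pushout_node_comm hE (Sum.inl i), fun j => pushout_node_comm hE (Sum.inr j),
    fun x => ?_, fun y => ?_, fun x => ?_, fun y => ?_,
    pushout_edge_bijective hD, pushout_edge_bijective hE, fun c => ?_, fun c => ?_,
    fun hinj => pushout_inr_injective hD hinj⟩
  · exact congrArg (fun k : discrete S X ⟶ D.G => onNode k x) h1
  · exact congrArg (fun k : discrete S Y ⟶ D.G => onNode k y) h2
  · exact congrArg (fun k : discrete S X ⟶ E.G => onNode k x) h3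
  · exact congrArg (fun k : discrete S Y ⟶ E.G => onNode k y) h4
  · obtain ⟨(j | x) | ⟨⟨o, e⟩, i⟩, hc⟩ := hC1.2 c
    · exact Or.inl ⟨j, hc⟩
    · exact Or.inr (Or.inl ⟨x, hc⟩)
    · exact Or.inr (Or.inr ⟨o, e, i, hc⟩)
  · obtain ⟨(j | x) | ⟨⟨o, e⟩, i⟩, hc⟩ := hC2.2 c
    · exact Or.inl ⟨j, hc⟩
    · exact Or.inr (Or.inl ⟨x, hc⟩)
    · exact Or.inr (Or.inr ⟨o, e, i, hc⟩)

namespace Weight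

variable {W : Weight}

theorem IsFlow.comp {G H : Hypergraph bialg} {p : H.V → ℕ} (hp : W.IsFlow H p) (f : G ⟶ H) :
    W.IsFlow G fun v => p (onNode f v) where
  mu e i := by
    obtain ⟨e', h1, h2⟩ : ∃ e' : H.Mu, onNode f (muSrc e i) = muSrc e' i ∧
        onNode f (muTgt e) = muTgt e' :=
      ⟨onEdge f BialgOp.mu e, onNode_src f _ _ _, onNode_tgt f _ _ _⟩
    rw [h1, h2, hp.mu]
  delta e := by
    obtain ⟨e', h1, h2⟩ : ∃ e' : H.Delta, onNode f (deltaSrc e) = deltaSrc e' ∧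
        ∀ i, onNode f (deltaTgt e i) = deltaTgt e' i :=
      ⟨onEdge f BialgOp.delta e, onNode_src f _ _ _, fun _ => onNode_tgt f _ _ _⟩
    rw [h1, h2, h2, hp.delta]
  eps e := by
    obtain ⟨e', h1⟩ : ∃ e' : H.Eps, onNode f (epsSrc e) = epsSrc e' :=
      ⟨onEdge f BialgOp.eps e, onNode_src f _ _ _⟩
    rw [h1, hp.eps]

/-- The functions of the recipe are monotone. -/
structure Mono (W : Weight) : Prop where
  mu : ∀ i, Monotone (W.mu i)
  delta : ∀ a b c d, a ≤ c → b ≤ d → W.delta a b ≤ W.delta c d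

theorem mono_u : Mono u := ⟨fun _ _ _ h => h, fun _ _ _ _ h h' => add_le_add h h'⟩

theorem mono_m : Mono m := ⟨fun _ _ _ h => h, fun _ _ _ _ h h' => by simp only [m]; omega⟩

theorem mono_muChain : Mono muChain :=
  ⟨fun _ _ _ h => by simp only [muChain]; split_ifs <;> omega, fun _ _ _ _ _ _ => le_rfl⟩

theorem mono_deltaTree : Mono deltaTree :=
  ⟨fun _ _ _ _ => le_rfl, fun _ _ _ _ h h' => by simp only [deltaTree]; omega⟩

end Weight

/-- The sum of the values of `p` at the `i`-th targets of the hyperedges labelled `o`. -/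
noncomputable def tgtSum (G : Hypergraph bialg) (o : bialg.Op) (i : Fin (bialg.coar o))
    (p : G.V → ℕ) : ℕ :=
  ∑ᶠ e : G.E o, p (G.tgt o e i)

/-- The sum, over the `μ`-hyperedges, of the value at the target. -/
noncomputable def muSum (G : Hypergraph bialg) (p : G.V → ℕ) : ℕ :=
  tgtSum G BialgOp.mu (0 : Fin 1) p

/-- The sum, over the `η`-hyperedges, of the value at the target. -/
noncomputable def etaSum (G : Hypergraph bialg) (p : G.V → ℕ) : ℕ :=
  tgtSum G BialgOp.eta (0 : Fin 1) p

/-- The sum, over the `δ`-hyperedges, of the value at the first target. -/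
noncomputable def deltaSum (G : Hypergraph bialg) (p : G.V → ℕ) : ℕ :=
  tgtSum G BialgOp.delta (0 : Fin 2) p

/-- Every output of the left-hand side of the rule is below every input. -/
def Rule.Connected {S : Signature} (ρ : Rule S) : Prop :=
  ∀ r, ρ.lhs.G.IsHeight r → ∀ i j, r (ρ.lhs.outNode j) < r (ρ.lhs.inNode i)

/-- For functions on the two sides of `ρ` following the recipe `W`, an inequality at the outputs
implies `P`. -/
def Weight.Forces (W : Weight) (ρ : Rule bialg)
    (P : (ρ.lhs.G.V → ℕ) → (ρ.rhs.G.V → ℕ) → Prop) : Prop :=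
  ∀ p q, W.IsFlow ρ.lhs.G p → W.IsFlow ρ.rhs.G q → (∀ v, W.base ≤ p v) →
    (∀ j, q (ρ.rhs.outNode j) ≤ p (ρ.lhs.outNode j)) → P p q

/-- The values of `W` at the inputs of a diagram do not increase along the rule `ρ`. -/
def Weight.Compatible (W : Weight) (ρ : Rule bialg) : Prop :=
  W.Forces ρ fun p q => ∀ i, q (ρ.rhs.inNode i) ≤ p (ρ.lhs.inNode i)

section Step

variable {ρ : Rule bialg} {D E : IHyp bialg X Y} {C : Hypergraph bialg}
  {f : ρ.lhs.G ⟶ D.G} {g : C ⟶ D.G} {f' : ρ.rhs.G ⟶ E.G} {g' : C ⟶ E.G}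
  {c₁ : Fin ρ.i → C.V} {c₂ : Fin ρ.j → C.V} {d₁ : X → C.V} {d₂ : Y → C.V}
  {W : Weight} {p : D.G.V → ℕ} {q : E.G.V → ℕ}

/-- Induction on the height in `D`. A context node is an output of the diagram, where both weights
equal the base; or a source of a context hyperedge, where both follow the recipe and monotonicity
applies; or an input of the rule. In the last case the outputs of the rule lie strictly lower by
`Rule.Connected`, so the induction hypothesis supplies the premise of `Weight.Compatible`. -/
theorem Decomposition.weight_le (h : Decomposition ρ D E C f g f' g' c₁ c₂ d₁ d₂)
    (hD : D.G.Acyclic) (hρ : ρ.Connected) (hW : W.Mono) (hWρ : W.Compatible ρ)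
    (hp : W.IsWeight D p) (hq : W.IsWeight E q) (hbase : ∀ v, W.base ≤ p v) (c : C.V) :
    q (onNode g' c) ≤ p (onNode g c) := by
  obtain ⟨r, hr⟩ := hD.exists_isHeight
  have hpC := hp.toIsFlow.comp g
  have hqC := hq.toIsFlow.comp g'
  have hrC := hr.comp g
  induction hN : r (onNode g c) using Nat.strong_induction_on generalizing c with
  | _ N ih =>
    subst hN
    rcases h.cases_src c with ⟨y, rfl⟩ | ⟨i, rfl⟩ | ⟨o, e, i, rfl⟩
    · rw [h.out_left, h.out_right, hp.base, hq.base]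
    · rw [← h.lhs_in, ← h.rhs_in]
      refine hWρ _ _ (hp.toIsFlow.comp f) (hq.toIsFlow.comp f') (fun v => hbase _) ?_ i
      intro j
      rw [h.lhs_out, h.rhs_out]
      refine ih _ ?_ _ rfl
      rw [← h.lhs_out, ← h.lhs_in]
      exact hρ _ (hr.comp f) i j
    · cases o with
      | mu => exact (hqC.mu e i).le.trans ((hW.mu i (ih _ (hrC.mu_lt e i) _ rfl)).trans
          (hpC.mu e i).ge)
      | eta => exact Fin.elim0 i
      | delta =>
        obtain rfl : i = (0 : Fin 1) := Subsingleton.elim (α := Fin 1) _ _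
        exact (hqC.delta e).le.trans ((hW.delta _ _ _ _ (ih _ (hrC.delta_lt e 0) _ rfl)
          (ih _ (hrC.delta_lt e 1) _ rfl)).trans (hpC.delta e).ge)
      | eps =>
        obtain rfl : i = (0 : Fin 1) := Subsingleton.elim (α := Fin 1) _ _
        exact (hqC.eps e).le.trans (hpC.eps e).ge

theorem Decomposition.tgtSum_left (h : Decomposition ρ D E C f g f' g' c₁ c₂ d₁ d₂)
    (o : bialg.Op) (i : Fin (bialg.coar o)) (p : D.G.V → ℕ) : tgtSum D.G o i p =
      tgtSum ρ.lhs.G o i (fun v => p (onNode f v)) + tgtSum C o i fun v => p (onNode g v) := by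
  simp only [tgtSum, onNode_tgt]
  exact finsum_sumElim (h.edge_left o) _

theorem Decomposition.tgtSum_right (h : Decomposition ρ D E C f g f' g' c₁ c₂ d₁ d₂)
    (o : bialg.Op) (i : Fin (bialg.coar o)) (q : E.G.V → ℕ) : tgtSum E.G o i q =
      tgtSum ρ.rhs.G o i (fun v => q (onNode f' v)) + tgtSum C o i fun v => q (onNode g' v) := by
  simp only [tgtSum, onNode_tgt]
  exact finsum_sumElim (h.edge_right o) _

/-- The hyperedges of the context contribute no more than before by `weight_le`; those of the rule
provide the drop `k`. -/
theorem Decomposition.tgtSum_add_le (h : Decomposition ρ D E C f g f' g' c₁ c₂ d₁ d₂)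
    (hD : D.G.Acyclic) (hρ : ρ.Connected) (hW : W.Mono) (hWρ : W.Compatible ρ)
    (hp : W.IsWeight D p) (hq : W.IsWeight E q) (hbase : ∀ v, W.base ≤ p v)
    (o : bialg.Op) (i : Fin (bialg.coar o)) (k : ℕ)
    (hk : W.Forces ρ fun p q => tgtSum ρ.rhs.G o i q + k ≤ tgtSum ρ.lhs.G o i p) :
    tgtSum E.G o i q + k ≤ tgtSum D.G o i p := by
  have hle := h.weight_le hD hρ hW hWρ hp hq hbase
  have h1 : tgtSum C o i (fun v => q (onNode g' v)) ≤ tgtSum C o i fun v => p (onNode g v) :=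
    finsum_le_finsum_of_finite fun e => hle _
  have h2 := hk _ _ (hp.toIsFlow.comp f) (hq.toIsFlow.comp f') (fun v => hbase _) fun j => by
    rw [h.lhs_out, h.rhs_out]
    exact hle _
  rw [h.tgtSum_left, h.tgtSum_right]
  dsimp only at h2
  omega

/-- From every node some path, possibly empty, leads to an output or an `ε`. This is why deleting an
`η` destroys a U-path. -/
theorem Weight.u_pos (hD : D.MonogamousAcyclic) (hp : Weight.u.IsWeight D p) (v : D.G.V) :
    1 ≤ p v := by
  obtain ⟨r, hr⟩ := hD.acyclic.exists_isHeight
  induction hN : r v using Nat.strong_induction_on generalizing v with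
  | _ N ih =>
    subst hN
    rcases hD.monogamous.output_or_src v with ⟨y, rfl⟩ | ⟨o, e, i, rfl⟩
    · exact (hp.base y).ge
    · cases o with
      | mu => exact (ih _ (hr.mu_lt e i) _ rfl).trans (hp.mu e i).ge
      | eta => exact Fin.elim0 i
      | delta =>
        obtain rfl : i = (0 : Fin 1) := Subsingleton.elim (α := Fin 1) _ _
        exact ((ih _ (hr.delta_lt e 0) _ rfl).trans (Nat.le_add_right _ _)).trans (hp.delta e).ge
      | eps =>
        obtain rfl : i = (0 : Fin 1) := Subsingleton.elim (α := Fin 1) _ _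
        exact (hp.eps e).ge

/-- If the number of paths decreases strictly at some node of the context, then it does so at an
input or at an `η`-hyperedge. -/
theorem Decomposition.exists_lt (h : Decomposition ρ D E C f g f' g' c₁ c₂ d₁ d₂)
    (hD : D.G.Acyclic) (hρ : ρ.Connected) (hp : Weight.u.IsWeight D p)
    (hq : Weight.u.IsWeight E q) (hle : ∀ c, q (onNode g' c) ≤ p (onNode g c)) (i₀ : Fin ρ.i)
    (hlt : q (onNode g' (c₁ i₀)) < p (onNode g (c₁ i₀))) :
    (∃ x, q (E.inNode x) < p (D.inNode x)) ∨
      ∃ e : C.Eta, q (onNode g' (etaTgt e)) < p (onNode g (etaTgt e)) := by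
  obtain ⟨r, hr⟩ := hD.exists_isHeight
  have hpC := hp.toIsFlow.comp g
  have hqC := hq.toIsFlow.comp g'
  have hrC := hr.comp g
  -- Take the highest node of the context where the weight drops; no hyperedge can carry the drop
  -- further back.
  obtain ⟨c, hc, hmax⟩ := Set.exists_max_image {c | q (onNode g' c) < p (onNode g c)}
    (fun c => r (onNode g c)) (Set.toFinite _) ⟨_, hlt⟩
  have hc' : q (onNode g' c) < p (onNode g c) := hc
  rcases h.cases_tgt c with ⟨j, rfl⟩ | ⟨x, rfl⟩ | ⟨o, e, i, rfl⟩
  -- The node cannot be an output of the rule: the input `i₀` also drops and lies strictly higher.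
  · have h1 := hmax _ hlt
    have h2 := hρ _ (hr.comp f) i₀ j
    rw [h.lhs_in, h.lhs_out] at h2
    omega
  · rw [h.in_left, h.in_right] at hc'
    exact Or.inl ⟨x, hc'⟩
  · cases o with
    | mu =>
      exfalso
      obtain rfl : i = (0 : Fin 1) := Subsingleton.elim (α := Fin 1) _ _
      -- For `Weight.u` a drop at a target of a `μ` or of a `δ` passes to its source, since the
      -- other summand at a `δ` does not increase. That source is higher, against the choice of the
      -- node.
      have h1 := hmax (muSrc (G := C) e 0)
        (show q (onNode g' (muSrc (G := C) e 0)) < p (onNode g (muSrc (G := C) e 0)) by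
          have h1 : q (onNode g' (muSrc (G := C) e 0)) = q (onNode g' (muTgt (G := C) e)) :=
            hqC.mu e 0
          have h2 : p (onNode g (muSrc (G := C) e 0)) = p (onNode g (muTgt (G := C) e)) :=
            hpC.mu e 0
          rw [h1, h2]
          exact hc')
      exact absurd (hrC.mu_lt e 0) (not_lt.2 h1)
    | eta =>
      obtain rfl : i = (0 : Fin 1) := Subsingleton.elim (α := Fin 1) _ _
      exact Or.inr ⟨e, hc'⟩
    | delta =>
      exfalso
      have h1 := hmax (deltaSrc (G := C) e)
        (show q (onNode g' (deltaSrc (G := C) e)) < p (onNode g (deltaSrc (G := C) e)) by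
          have h1 : q (onNode g' (deltaSrc (G := C) e)) = q (onNode g' (deltaTgt (G := C) e 0)) +
            q (onNode g' (deltaTgt (G := C) e 1)) := hqC.delta e
          have h2 : p (onNode g (deltaSrc (G := C) e)) = p (onNode g (deltaTgt (G := C) e 0)) +
            p (onNode g (deltaTgt (G := C) e 1)) := hpC.delta e
          have h3 := hle (deltaTgt (G := C) e 0)
          have h4 := hle (deltaTgt (G := C) e 1)
          have h5 : q (onNode g' (deltaTgt (G := C) e 0)) < p (onNode g (deltaTgt (G := C) e 0)) ∨
              q (onNode g' (deltaTgt (G := C) e 1)) < p (onNode g (deltaTgt (G := C) e 1)) := by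
            change Fin 2 at i
            fin_cases i
            · exact Or.inl hc'
            · exact Or.inr hc'
          omega)
      exact absurd (hrC.delta_lt e i) (not_lt.2 h1)
    | eps => exact Fin.elim0 i

end Step

end Transfer

/-! ### Hypergraphs given by lists -/

section Concrete

variable {k : ℕ} {mus : List (Fin k × Fin k × Fin k)} {etas : List (Fin k)}
  {deltas : List (Fin k × Fin k × Fin k)} {epss : List (Fin k)}

theorem finsum_get {A : Type} (l : List A) (φ : A → ℕ) :
    ∑ᶠ e : Fin l.length, φ (l.get e) = (l.map φ).sum := by
  rw [finsum_eq_sum_of_fintype]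
  exact Fin.sum_univ_fun_getElem l φ

theorem muSum_mkHyp (p : Fin k → ℕ) :
    muSum (mkHyp k mus etas deltas epss) p = (mus.map fun t => p t.2.2).sum :=
  finsum_get mus fun t => p t.2.2

theorem etaSum_mkHyp (p : Fin k → ℕ) :
    etaSum (mkHyp k mus etas deltas epss) p = (etas.map p).sum :=
  finsum_get etas p

theorem deltaSum_mkHyp (p : Fin k → ℕ) :
    deltaSum (mkHyp k mus etas deltas epss) p = (deltas.map fun t => p t.2.1).sum :=
  finsum_get deltas fun t => p t.2.1

/-- The equations stating that `p` follows the recipe `W` along the listed hyperedges. -/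
def Weight.ListFlow (W : Weight) (mus deltas : List (Fin k × Fin k × Fin k)) (epss : List (Fin k))
    (p : Fin k → ℕ) : Prop :=
  (∀ t ∈ mus, p t.1 = W.mu 0 (p t.2.2) ∧ p t.2.1 = W.mu 1 (p t.2.2)) ∧
    (∀ t ∈ deltas, p t.1 = W.delta (p t.2.1) (p t.2.2)) ∧ ∀ a ∈ epss, p a = W.eps

/-- Quantification over list members, unlike over hyperedge types, is expanded by `simp` into
finitely many equations for `omega`. -/
theorem Weight.IsFlow.listFlow {W : Weight} {p : Fin k → ℕ}
    (h : W.IsFlow (mkHyp k mus etas deltas epss) p) : W.ListFlow mus deltas epss p := by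
  refine ⟨fun t ht => ?_, fun t ht => ?_, fun a ha => ?_⟩
  · obtain ⟨e, rfl⟩ := List.get_of_mem ht
    exact ⟨h.mu e 0, h.mu e 1⟩
  · obtain ⟨e, rfl⟩ := List.get_of_mem ht
    exact h.delta e
  · obtain ⟨e, rfl⟩ := List.get_of_mem ha
    exact h.eps e

theorem isHeight_mkHyp_iff {r : Fin k → ℕ} : (mkHyp k mus etas deltas epss).IsHeight r ↔
    (∀ t ∈ mus, r t.2.2 < r t.1 ∧ r t.2.2 < r t.2.1) ∧
      ∀ t ∈ deltas, r t.2.1 < r t.1 ∧ r t.2.2 < r t.1 := by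
  constructor
  · intro h
    refine ⟨fun t ht => ?_, fun t ht => ?_⟩
    · obtain ⟨e, rfl⟩ := List.get_of_mem ht
      exact ⟨h.mu_lt e 0, h.mu_lt e 1⟩
    · obtain ⟨e, rfl⟩ := List.get_of_mem ht
      exact ⟨h.delta_lt e 0, h.delta_lt e 1⟩
  · rintro ⟨h1, h2⟩ o e i j
    cases o with
    | mu =>
      obtain rfl : j = (0 : Fin 1) := Subsingleton.elim (α := Fin 1) _ _
      have := h1 (mus.get e) (List.get_mem _ _)
      change Fin 2 at i
      fin_cases i
      exacts [this.1, this.2]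
    | eta => exact Fin.elim0 i
    | delta =>
      obtain rfl : i = (0 : Fin 1) := Subsingleton.elim (α := Fin 1) _ _
      have := h2 (deltas.get e) (List.get_mem _ _)
      change Fin 2 at j
      fin_cases j
      exacts [this.1, this.2]
    | eps => exact Fin.elim0 j

/-- The inputs and the targets of hyperedges of a listed hypergraph. -/
def mkTgt (mus : List (Fin k × Fin k × Fin k)) (etas : List (Fin k))
    (deltas : List (Fin k × Fin k × Fin k)) {i : ℕ} (inp : Fin i → Fin k) :
    Fin i ⊕ Fin mus.length ⊕ Fin etas.length ⊕ Fin deltas.length × Fin 2 → Fin k :=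
  Sum.elim inp (Sum.elim (fun e => (mus.get e).2.2) (Sum.elim (fun e => etas.get e)
    fun e => ![(deltas.get e.1).2.1, (deltas.get e.1).2.2] e.2))

/-- The outputs and the sources of hyperedges of a listed hypergraph. -/
def mkSrc (mus : List (Fin k × Fin k × Fin k)) (deltas : List (Fin k × Fin k × Fin k))
    (epss : List (Fin k)) {j : ℕ} (out : Fin j → Fin k) :
    Fin j ⊕ (Fin mus.length × Fin 2) ⊕ Fin deltas.length ⊕ Fin epss.length → Fin k :=
  Sum.elim out (Sum.elim (fun e => ![(mus.get e.1).1, (mus.get e.1).2.1] e.2)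
    (Sum.elim (fun e => (deltas.get e).1) fun e => epss.get e))

/-- The two bijections of monogamy are transported to maps between explicit finite types, where they
can be decided. -/
theorem monogamousAcyclic_mkIHyp {i j : ℕ} {inp : Fin i → Fin k} {out : Fin j → Fin k}
    (ht : Function.Bijective (mkTgt mus etas deltas inp))
    (hs : Function.Bijective (mkSrc mus deltas epss out)) (r : Fin k → ℕ)
    (hr : (∀ t ∈ mus, r t.2.2 < r t.1 ∧ r t.2.2 < r t.2.1) ∧
      ∀ t ∈ deltas, r t.2.1 < r t.1 ∧ r t.2.2 < r t.1) :
    (mkIHyp k mus etas deltas epss inp out).MonogamousAcyclic := by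
  refine ⟨(IHyp.monogamous_iff _).2 ⟨?_, ?_⟩, (isHeight_mkHyp_iff.2 hr).acyclic⟩
  · let G := mkHyp k mus etas deltas epss
    let τ : Fin i ⊕ Fin mus.length ⊕ Fin etas.length ⊕ Fin deltas.length × Fin 2 →
        Fin i ⊕ (Σ h : G.Edge, Fin (bialg.coar h.1)) :=
      Sum.map id (Sum.elim (fun e => ⟨muEdge (G := G) e, (0 : Fin 1)⟩)
        (Sum.elim (fun e => ⟨etaEdge (G := G) e, (0 : Fin 1)⟩)
          fun e => ⟨deltaEdge (G := G) e.1, e.2⟩))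
    have hτ : Function.Surjective τ := by
      rintro (x | ⟨⟨o, e⟩, l⟩)
      · exact ⟨Sum.inl x, rfl⟩
      · cases o with
        | mu =>
          obtain rfl : l = (0 : Fin 1) := Subsingleton.elim (α := Fin 1) _ _
          exact ⟨Sum.inr (Sum.inl e), rfl⟩
        | eta =>
          obtain rfl : l = (0 : Fin 1) := Subsingleton.elim (α := Fin 1) _ _
          exact ⟨Sum.inr (Sum.inr (Sum.inl e)), rfl⟩
        | delta => exact ⟨Sum.inr (Sum.inr (Sum.inr (e, l))), rfl⟩
        | eps => exact Fin.elim0 l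
    have hcomp : Sum.elim (onNode (mkIHyp k mus etas deltas epss inp out).inp) G.tgtMap ∘ τ =
        mkTgt mus etas deltas inp := by
      funext x
      rcases x with x | x | x | x <;> rfl
    -- Only surjectivity of `τ` was checked by hand; injectivity is inherited from the injective
    -- composite.
    have hinj : Function.Injective τ := Function.Injective.of_comp (hcomp ▸ ht.1)
    exact (Function.Bijective.of_comp_iff _ ⟨hinj, hτ⟩).1 (hcomp ▸ ht)
  · let G := mkHyp k mus etas deltas epss
    let τ : Fin j ⊕ (Fin mus.length × Fin 2) ⊕ Fin deltas.length ⊕ Fin epss.length →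
        Fin j ⊕ (Σ h : G.Edge, Fin (bialg.ar h.1)) :=
      Sum.map id (Sum.elim (fun e => ⟨muEdge (G := G) e.1, e.2⟩)
        (Sum.elim (fun e => ⟨deltaEdge (G := G) e, (0 : Fin 1)⟩)
          fun e => ⟨epsEdge (G := G) e, (0 : Fin 1)⟩))
    have hτ : Function.Surjective τ := by
      rintro (x | ⟨⟨o, e⟩, l⟩)
      · exact ⟨Sum.inl x, rfl⟩
      · cases o with
        | mu => exact ⟨Sum.inr (Sum.inl (e, l)), rfl⟩
        | eta => exact Fin.elim0 l
        | delta =>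
          obtain rfl : l = (0 : Fin 1) := Subsingleton.elim (α := Fin 1) _ _
          exact ⟨Sum.inr (Sum.inr (Sum.inl e)), rfl⟩
        | eps =>
          obtain rfl : l = (0 : Fin 1) := Subsingleton.elim (α := Fin 1) _ _
          exact ⟨Sum.inr (Sum.inr (Sum.inr e)), rfl⟩
    have hcomp : Sum.elim (onNode (mkIHyp k mus etas deltas epss inp out).out) G.srcMap ∘ τ =
        mkSrc mus deltas epss out := by
      funext x
      rcases x with x | x | x | x <;> rfl
    have hinj : Function.Injective τ := Function.Injective.of_comp (hcomp ▸ hs.1)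
    exact (Function.Bijective.of_comp_iff _ ⟨hinj, hτ⟩).1 (hcomp ▸ hs)

theorem card_mu_mkHyp : Nat.card (mkHyp k mus etas deltas epss).Mu = mus.length :=
  Nat.card_fin _

theorem card_delta_mkHyp : Nat.card (mkHyp k mus etas deltas epss).Delta = deltas.length :=
  Nat.card_fin _

end Concrete

/-! ### Local inequalities for the ten rules -/

section Rules

variable {i j kL kR : ℕ} {musL : List (Fin kL × Fin kL × Fin kL)} {etasL : List (Fin kL)}
  {deltasL : List (Fin kL × Fin kL × Fin kL)} {epssL : List (Fin kL)} {inL : Fin i → Fin kL}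
  {outL : Fin j → Fin kL} {musR : List (Fin kR × Fin kR × Fin kR)} {etasR : List (Fin kR)}
  {deltasR : List (Fin kR × Fin kR × Fin kR)} {epssR : List (Fin kR)} {inR : Fin i → Fin kR}
  {outR : Fin j → Fin kR} {W : Weight}

theorem forces_mk {P : (Fin kL → ℕ) → (Fin kR → ℕ) → Prop}
    (h : ∀ p q, W.ListFlow musL deltasL epssL p → W.ListFlow musR deltasR epssR q →
      (∀ v, W.base ≤ p v) → (∀ y, q (outR y) ≤ p (outL y)) → P p q) :
    W.Forces ⟨i, j, mkIHyp kL musL etasL deltasL epssL inL outL,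
      mkIHyp kR musR etasR deltasR epssR inR outR⟩ P :=
  fun p q hp hq => h p q hp.listFlow hq.listFlow

theorem compatible_mk
    (h : ∀ p q, W.ListFlow musL deltasL epssL p → W.ListFlow musR deltasR epssR q →
      (∀ v, W.base ≤ p v) → (∀ y, q (outR y) ≤ p (outL y)) → ∀ x, q (inR x) ≤ p (inL x)) :
    W.Compatible ⟨i, j, mkIHyp kL musL etasL deltasL epssL inL outL,
      mkIHyp kR musR etasR deltasR epssR inR outR⟩ :=
  forces_mk h

theorem connected_mk
    (h : ∀ r : Fin kL → ℕ, (∀ t ∈ musL, r t.2.2 < r t.1 ∧ r t.2.2 < r t.2.1) →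
      (∀ t ∈ deltasL, r t.2.1 < r t.1 ∧ r t.2.2 < r t.1) → ∀ x y, r (outL y) < r (inL x)) :
    Rule.Connected ⟨i, j, mkIHyp kL musL etasL deltasL epssL inL outL,
      mkIHyp kR musR etasR deltasR epssR inR outR⟩ :=
  fun r hr => h r (isHeight_mkHyp_iff.1 hr).1 (isHeight_mkHyp_iff.1 hr).2

/-- A step by the rule `ρ` decreases the sum of `W` over a kind of hyperedges by at least `k`. -/
structure Weight.Controls (W : Weight) (ρ : Rule bialg) (o : bialg.Op) (i : Fin (bialg.coar o))
    (k : ℕ) : Prop where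
  compatible : W.Compatible ρ
  sum_le : W.Forces ρ fun p q => tgtSum ρ.rhs.G o i q + k ≤ tgtSum ρ.lhs.G o i p

theorem controls_eta_mk {k : ℕ}
    (h : ∀ p q, W.ListFlow musL deltasL epssL p → W.ListFlow musR deltasR epssR q →
      (∀ v, W.base ≤ p v) → (∀ y, q (outR y) ≤ p (outL y)) →
        (∀ x, q (inR x) ≤ p (inL x)) ∧ (etasR.map q).sum + k ≤ (etasL.map p).sum) :
    W.Controls ⟨i, j, mkIHyp kL musL etasL deltasL epssL inL outL,
      mkIHyp kR musR etasR deltasR epssR inR outR⟩ BialgOp.eta (0 : Fin 1) k :=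
  ⟨compatible_mk fun p q h1 h2 h3 h4 => (h p q h1 h2 h3 h4).1,
    forces_mk fun p q h1 h2 h3 h4 =>
      (Nat.add_le_add_right (etaSum_mkHyp q).le k).trans
        ((h p q h1 h2 h3 h4).2.trans (etaSum_mkHyp p).ge)⟩

theorem controls_mu_mk {k : ℕ}
    (h : ∀ p q, W.ListFlow musL deltasL epssL p → W.ListFlow musR deltasR epssR q →
      (∀ v, W.base ≤ p v) → (∀ y, q (outR y) ≤ p (outL y)) →
        (∀ x, q (inR x) ≤ p (inL x)) ∧
          (musR.map fun t => q t.2.2).sum + k ≤ (musL.map fun t => p t.2.2).sum) :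
    W.Controls ⟨i, j, mkIHyp kL musL etasL deltasL epssL inL outL,
      mkIHyp kR musR etasR deltasR epssR inR outR⟩ BialgOp.mu (0 : Fin 1) k :=
  ⟨compatible_mk fun p q h1 h2 h3 h4 => (h p q h1 h2 h3 h4).1,
    forces_mk fun p q h1 h2 h3 h4 =>
      (Nat.add_le_add_right (muSum_mkHyp q).le k).trans
        ((h p q h1 h2 h3 h4).2.trans (muSum_mkHyp p).ge)⟩

theorem controls_delta_mk {k : ℕ}
    (h : ∀ p q, W.ListFlow musL deltasL epssL p → W.ListFlow musR deltasR epssR q →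
      (∀ v, W.base ≤ p v) → (∀ y, q (outR y) ≤ p (outL y)) →
        (∀ x, q (inR x) ≤ p (inL x)) ∧
          (deltasR.map fun t => q t.2.1).sum + k ≤ (deltasL.map fun t => p t.2.1).sum) :
    W.Controls ⟨i, j, mkIHyp kL musL etasL deltasL epssL inL outL,
      mkIHyp kR musR etasR deltasR epssR inR outR⟩ BialgOp.delta (0 : Fin 2) k :=
  ⟨compatible_mk fun p q h1 h2 h3 h4 => (h p q h1 h2 h3 h4).1,
    forces_mk fun p q h1 h2 h3 h4 =>
      (Nat.add_le_add_right (deltaSum_mkHyp q).le k).trans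
        ((h p q h1 h2 h3 h4).2.trans (deltaSum_mkHyp p).ge)⟩

theorem connected_of_mem_BA : ∀ ρ ∈ BA, ρ.Connected := by
  rintro ρ (rfl | rfl | rfl | rfl | rfl | rfl | rfl | rfl | rfl | rfl) <;>
    refine connected_mk fun r hm hd => ?_ <;>
    simp [Fin.forall_fin_succ] at hm hd ⊢ <;> omega

theorem injective_of_mem_BA : ∀ ρ ∈ BA,
    Function.Injective (Sum.elim ρ.lhs.inNode ρ.lhs.outNode) := by
  rintro ρ (rfl | rfl | rfl | rfl | rfl | rfl | rfl | rfl | rfl | rfl)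
  · exact (by decide : Function.Injective (Sum.elim ![0, 1, 2] ![4] : _ → Fin 5))
  · exact (by decide : Function.Injective (Sum.elim ![0] ![2, 3, 4] : _ → Fin 5))
  · exact (by decide : Function.Injective (Sum.elim ![0] ![2] : _ → Fin 3))
  · exact (by decide : Function.Injective (Sum.elim ![0] ![2] : _ → Fin 3))
  · exact (by decide : Function.Injective (Sum.elim ![0] ![2] : _ → Fin 3))
  · exact (by decide : Function.Injective (Sum.elim ![0] ![1] : _ → Fin 3))
  · exact (by decide : Function.Injective (Sum.elim ![] ![1, 2] : _ → Fin 3))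
  · exact (by decide : Function.Injective (Sum.elim ![0, 1] ![] : _ → Fin 3))
  · exact (by decide : Function.Injective (Sum.elim ![0, 1] ![3, 4] : _ → Fin 5))
  · exact (by decide : Function.Injective (Sum.elim ![] ![] : _ → Fin 1))

theorem rhs_monogamousAcyclic_of_mem_BA : ∀ ρ ∈ BA, ρ.rhs.MonogamousAcyclic := by
  rintro ρ (rfl | rfl | rfl | rfl | rfl | rfl | rfl | rfl | rfl | rfl) <;>
    -- In each right-hand side the node numbers increase along every hyperedge, and there are at
    -- most 8 nodes, so `8 - v` is a height.
    exact monogamousAcyclic_mkIHyp (by decide) (by decide) (fun v => 8 - v.1) (by simp)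

theorem controls_u_of_mem_BA : ∀ ρ ∈ BA,
    Weight.u.Controls ρ BialgOp.eta (0 : Fin 1) 0 := by
  rintro ρ (rfl | rfl | rfl | rfl | rfl | rfl | rfl | rfl | rfl | rfl) <;>
    refine controls_eta_mk fun p q hp hq hb ho => ?_ <;>
    simp [Weight.ListFlow, Weight.u, Fin.forall_fin_succ] at hp hq hb ho ⊢ <;> omega

/-- The deleted `η` had weight at least 1: by `Weight.u_pos` in the unit rules, and by the weight of
the `ε` in rule 10. -/
theorem controls_u_strict : ∀ ρ ∈ ({BA3, BA4, BA10} : Set (Rule bialg)),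
    Weight.u.Controls ρ BialgOp.eta (0 : Fin 1) 1 := by
  rintro ρ (rfl | rfl | rfl) <;>
    refine controls_eta_mk fun p q hp hq hb ho => ?_ <;>
    simp [Weight.ListFlow, Weight.u, Fin.forall_fin_succ] at hp hq hb ho ⊢ <;> omega

/-- The left-hand side offers one extra path from its input, the one ending in the `ε`. No `η`
occurs in these rules, so the drop is visible only at the input. -/
theorem forces_u_lt : ∀ ρ ∈ ({BA5, BA6} : Set (Rule bialg)),
    Weight.u.Forces ρ fun p q => ∃ x, q (ρ.rhs.inNode x) < p (ρ.lhs.inNode x) := by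
  rintro ρ (rfl | rfl) <;>
    refine forces_mk fun p q hp hq hb ho => ⟨(0 : Fin 1), show q 0 < p 0 from ?_⟩ <;>
    simp [Weight.ListFlow, Weight.u, Fin.forall_fin_succ] at hp hq hb ho ⊢ <;> omega

theorem controls_m : ∀ ρ ∈ ({BA1, BA2, BA7, BA8} : Set (Rule bialg)),
    Weight.m.Controls ρ BialgOp.mu (0 : Fin 1) 0 := by
  rintro ρ (rfl | rfl | rfl | rfl) <;>
    refine controls_mu_mk fun p q hp hq hb ho => ?_ <;>
    simp [Weight.ListFlow, Weight.m, Fin.forall_fin_succ] at hp hq hb ho ⊢ <;> omega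

/-- On the left the target of the `μ` has weight `1 + (a + b)`, with `a` and `b` the weights at the
outputs; on the right the two `μ`-targets are the outputs themselves and together contribute at most
`a + b`. The bound at the inputs is `1 + (a + b)`, as before. -/
theorem controls_m_BA9 : Weight.m.Controls BA9 BialgOp.mu (0 : Fin 1) 1 := by
  refine controls_mu_mk fun p q hp hq hb ho => ?_
  simp [Weight.ListFlow, Weight.m, Fin.forall_fin_succ] at hp hq hb ho ⊢
  omega

/-- With weight `a` at the output, the `μ`-targets on the left have weights `a + 1` and `a`, since
the inner tree hangs at a first source; on the right it hangs at a second source and both weights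
are at most `a`. -/
theorem controls_muChain_BA1 : Weight.muChain.Controls BA1 BialgOp.mu (0 : Fin 1) 1 := by
  refine controls_mu_mk fun p q hp hq hb ho => ?_
  simp [Weight.ListFlow, Weight.muChain, Fin.forall_fin_succ] at hp hq hb ho ⊢
  omega

theorem controls_muChain_BA2 : Weight.muChain.Controls BA2 BialgOp.mu (0 : Fin 1) 0 := by
  refine controls_mu_mk fun p q hp hq hb ho => ?_
  simp [Weight.ListFlow, Weight.muChain, Fin.forall_fin_succ] at hp hq hb ho ⊢
  omega

theorem controls_deltaTree_BA1 : Weight.deltaTree.Controls BA1 BialgOp.delta (0 : Fin 2) 0 := by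
  refine controls_delta_mk fun p q hp hq hb ho => ?_
  simp [Weight.ListFlow, Weight.deltaTree, Fin.forall_fin_succ] at hp hq hb ho ⊢
  omega

/-- On the left the inner `δ` belongs to the tree at the first target of the outer one and is
counted there; on the right it hangs at the second target. -/
theorem controls_deltaTree_BA2 : Weight.deltaTree.Controls BA2 BialgOp.delta (0 : Fin 2) 1 := by
  refine controls_delta_mk fun p q hp hq hb ho => ?_
  simp [Weight.ListFlow, Weight.deltaTree, Fin.forall_fin_succ] at hp hq hb ho ⊢
  omega

end Rules

/-! ### Global inequalities along a step -/

section StepBounds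

variable {n m : ℕ} {ρ : Rule bialg} {D E : IHyp bialg (Fin n) (Fin m)}

-- Bare wires survive: `C → D` is injective on nodes, so an input and an output equal in `D` were
-- already equal in `C`, hence are equal in `E`. This is the direction needed, because bare wires
-- are subtracted in the count of U-paths.
open Classical in
theorem Decomposition.sum_output_le {C : Hypergraph bialg} {f : ρ.lhs.G ⟶ D.G} {g : C ⟶ D.G}
    {f' : ρ.rhs.G ⟶ E.G} {g' : C ⟶ E.G} {c₁ : Fin ρ.i → C.V} {c₂ : Fin ρ.j → C.V}
    {d₁ : Fin n → C.V} {d₂ : Fin m → C.V} (h : Decomposition ρ D E C f g f' g' c₁ c₂ d₁ d₂)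
    (hρ : Function.Injective (Sum.elim ρ.lhs.inNode ρ.lhs.outNode)) :
    ∑ x : Fin n, (if D.IsOutput (D.inNode x) then 1 else 0) ≤
      ∑ x : Fin n, if E.IsOutput (E.inNode x) then 1 else 0 := by
  refine Finset.sum_le_sum fun x _ => ?_
  by_cases hx : D.IsOutput (D.inNode x)
  · have hy : E.IsOutput (E.inNode x) := by
      obtain ⟨y, hy⟩ := hx
      have hxy : d₂ y = d₁ x := h.injective hρ ((h.out_left y).trans (hy.trans (h.in_left x).symm))
      exact ⟨y, (h.out_right y).symm.trans (hxy ▸ h.in_right x)⟩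
    rw [if_pos hx, if_pos hy]
  · rw [if_neg hx]
    exact Nat.zero_le _

theorem RuleStep.card_uPath_add_le (h : RuleStep ρ D E) (hρ : ρ ∈ BA)
    (hD : D.MonogamousAcyclic) (hE : E.MonogamousAcyclic) (k : ℕ)
    (hk : Weight.u.Controls ρ BialgOp.eta (0 : Fin 1) k) :
    Nat.card (UPath E) + k ≤ Nat.card (UPath D) := by
  obtain ⟨C, f, g, f', g', c₁, c₂, d₁, d₂, h⟩ := h.exists_decomposition
  obtain ⟨-, p, hp, hpc⟩ := exists_weight_u hD
  obtain ⟨-, q, hq, hqc⟩ := exists_weight_u hE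
  have hle := h.weight_le hD.acyclic (connected_of_mem_BA ρ hρ) Weight.mono_u hk.compatible hp hq
    (Weight.u_pos hD hp)
  have h1 := h.sum_output_le (injective_of_mem_BA ρ hρ)
  have h2 : ∑ x : Fin n, q (E.inNode x) ≤ ∑ x : Fin n, p (D.inNode x) :=
    Finset.sum_le_sum fun x _ => by
      rw [← h.in_left, ← h.in_right]
      exact hle _
  have h3 : ∑ᶠ e : E.G.Eta, q (etaTgt e) + k ≤ ∑ᶠ e : D.G.Eta, p (etaTgt e) :=
    h.tgtSum_add_le hD.acyclic (connected_of_mem_BA ρ hρ) Weight.mono_u hk.compatible hp hq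
      (Weight.u_pos hD hp) _ _ k hk.sum_le
  omega

/-- The strict drop at an input of the rule is propagated backwards by `Decomposition.exists_lt` to
a summand of the formula for U-paths: an input of the diagram or an `η` of the context. -/
theorem RuleStep.card_uPath_lt (h : RuleStep ρ D E) (hρ : ρ ∈ BA)
    (hD : D.MonogamousAcyclic) (hE : E.MonogamousAcyclic)
    (hlt : Weight.u.Forces ρ fun p q => ∃ x, q (ρ.rhs.inNode x) < p (ρ.lhs.inNode x)) :
    Nat.card (UPath E) < Nat.card (UPath D) := by
  have hk := controls_u_of_mem_BA ρ hρ
  obtain ⟨C, f, g, f', g', c₁, c₂, d₁, d₂, h⟩ := h.exists_decomposition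
  obtain ⟨-, p, hp, hpc⟩ := exists_weight_u hD
  obtain ⟨-, q, hq, hqc⟩ := exists_weight_u hE
  have hle := h.weight_le hD.acyclic (connected_of_mem_BA ρ hρ) Weight.mono_u hk.compatible hp hq
    (Weight.u_pos hD hp)
  have h1 := h.sum_output_le (injective_of_mem_BA ρ hρ)
  have hin : ∀ x : Fin n, q (E.inNode x) ≤ p (D.inNode x) := fun x => by
    rw [← h.in_left, ← h.in_right]
    exact hle _
  have h2 : ∑ x : Fin n, q (E.inNode x) ≤ ∑ x : Fin n, p (D.inNode x) :=
    Finset.sum_le_sum fun x _ => hin x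
  have h3 : ∑ᶠ e : E.G.Eta, q (etaTgt e) ≤ ∑ᶠ e : D.G.Eta, p (etaTgt e) :=
    h.tgtSum_add_le hD.acyclic (connected_of_mem_BA ρ hρ) Weight.mono_u hk.compatible hp hq
      (Weight.u_pos hD hp) _ _ 0 hk.sum_le
  obtain ⟨x₀, hx₀⟩ := hlt _ _ (hp.toIsFlow.comp f) (hq.toIsFlow.comp f')
    (fun v => Weight.u_pos hD hp _) fun j => by
      rw [h.lhs_out, h.rhs_out]
      exact hle _
  beta_reduce at hx₀
  rw [h.lhs_in, h.rhs_in] at hx₀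
  rcases h.exists_lt hD.acyclic (connected_of_mem_BA ρ hρ) hp hq hle x₀ hx₀ with ⟨x, hx⟩ | ⟨e, he⟩
  · have h2' : ∑ x : Fin n, q (E.inNode x) < ∑ x : Fin n, p (D.inNode x) :=
      Finset.sum_lt_sum (fun x _ => hin x) ⟨x, Finset.mem_univ x, hx⟩
    omega
  · have h4 := h.tgtSum_left BialgOp.eta (0 : Fin 1) p
    have h5 := h.tgtSum_right BialgOp.eta (0 : Fin 1) q
    have h6 : tgtSum C BialgOp.eta (0 : Fin 1) (fun v => q (onNode g' v)) <
        tgtSum C BialgOp.eta (0 : Fin 1) fun v => p (onNode g v) :=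
      finsum_lt_finsum_of_finite (A := C.Eta) (fun e => hle _) e he
    have h7 := hk.sum_le _ _ (hp.toIsFlow.comp f) (hq.toIsFlow.comp f')
      (fun v => Weight.u_pos hD hp _) fun j => by
        rw [h.lhs_out, h.rhs_out]
        exact hle _
    have h8 : ∑ᶠ e : E.G.Eta, q (etaTgt e) < ∑ᶠ e : D.G.Eta, p (etaTgt e) := by
      change tgtSum E.G BialgOp.eta (0 : Fin 1) q < tgtSum D.G BialgOp.eta (0 : Fin 1) p
      omega
    omega

theorem RuleStep.card_mPath_add_le (h : RuleStep ρ D E) (hρ : ρ ∈ BA)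
    (hD : D.MonogamousAcyclic) (hE : E.MonogamousAcyclic) (k : ℕ)
    (hk : Weight.m.Controls ρ BialgOp.mu (0 : Fin 1) k) :
    Nat.card (MPath E) + k ≤ Nat.card (MPath D) := by
  obtain ⟨C, f, g, f', g', c₁, c₂, d₁, d₂, h⟩ := h.exists_decomposition
  obtain ⟨-, p, hp, hpc⟩ := exists_weight_m hD
  obtain ⟨-, q, hq, hqc⟩ := exists_weight_m hE
  rw [hpc, hqc]
  exact h.tgtSum_add_le hD.acyclic (connected_of_mem_BA ρ hρ) Weight.mono_m hk.compatible hp hq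
    (fun _ => Nat.zero_le _) _ _ k hk.sum_le

theorem RuleStep.lWeight_add_le (h : RuleStep ρ D E) (hρ : ρ ∈ BA)
    (hD : D.MonogamousAcyclic) (hE : E.MonogamousAcyclic) (k l : ℕ)
    (hk : Weight.muChain.Controls ρ BialgOp.mu (0 : Fin 1) k)
    (hl : Weight.deltaTree.Controls ρ BialgOp.delta (0 : Fin 2) l) :
    LWeight E.G + (k + l) ≤ LWeight D.G := by
  obtain ⟨C, f, g, f', g', c₁, c₂, d₁, d₂, h⟩ := h.exists_decomposition
  obtain ⟨p, p', hp, hp', hpc⟩ := lWeight_eq hD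
  obtain ⟨q, q', hq, hq', hqc⟩ := lWeight_eq hE
  have h1 : ∑ᶠ e : E.G.Mu, q (muTgt e) + k ≤ ∑ᶠ e : D.G.Mu, p (muTgt e) :=
    h.tgtSum_add_le hD.acyclic (connected_of_mem_BA ρ hρ) Weight.mono_muChain hk.compatible hp hq
      (fun _ => Nat.zero_le _) _ _ k hk.sum_le
  have h2 : ∑ᶠ e : E.G.Delta, q' (deltaTgt e 0) + l ≤ ∑ᶠ e : D.G.Delta, p' (deltaTgt e 0) :=
    h.tgtSum_add_le hD.acyclic (connected_of_mem_BA ρ hρ) Weight.mono_deltaTree hl.compatible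
      hp' hq' (fun _ => Nat.zero_le _) _ _ l hl.sum_le
  omega

theorem RuleStep.card_mu (h : RuleStep ρ D E) : Nat.card E.G.Mu + Nat.card ρ.lhs.G.Mu =
    Nat.card D.G.Mu + Nat.card ρ.rhs.G.Mu := by
  obtain ⟨C, f, g, f', g', c₁, c₂, d₁, d₂, h⟩ := h.exists_decomposition
  have h1 : Nat.card D.G.Mu = Nat.card ρ.lhs.G.Mu + Nat.card C.Mu :=
    natCard_sumElim (h.edge_left BialgOp.mu)
  have h2 : Nat.card E.G.Mu = Nat.card ρ.rhs.G.Mu + Nat.card C.Mu :=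
    natCard_sumElim (h.edge_right BialgOp.mu)
  omega

theorem RuleStep.card_delta (h : RuleStep ρ D E) : Nat.card E.G.Delta + Nat.card ρ.lhs.G.Delta =
    Nat.card D.G.Delta + Nat.card ρ.rhs.G.Delta := by
  obtain ⟨C, f, g, f', g', c₁, c₂, d₁, d₂, h⟩ := h.exists_decomposition
  have h1 : Nat.card D.G.Delta = Nat.card ρ.lhs.G.Delta + Nat.card C.Delta :=
    natCard_sumElim (h.edge_left BialgOp.delta)
  have h2 : Nat.card E.G.Delta = Nat.card ρ.rhs.G.Delta + Nat.card C.Delta :=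
    natCard_sumElim (h.edge_right BialgOp.delta)
  omega

end StepBounds

/-! ### Preorders given by measures and their lexicographic combination -/

section Orderings

variable {α : Type*}

/-- The preorder comparing the values of a function. -/
def MeasureLE {β : Type*} [LE β] (f : α → β) (a b : α) : Prop := f a ≤ f b

theorem strictRel_measureLE {β : Type*} [LinearOrder β] (f : α → β) (a b : α) :
    StrictRel (MeasureLE f) a b ↔ f a < f b := by
  simp only [StrictRel, EquivRel, MeasureLE, lt_iff_le_not_ge]
  tauto

theorem isWellFoundedPreorder_measureLE {β : Type*} [LinearOrder β] [WellFoundedLT β]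
    (f : α → β) : IsWellFoundedPreorder (MeasureLE f) where
  refl _ := le_refl _
  trans _ _ _ := le_trans
  wf := by
    have : StrictRel (MeasureLE f) = InvImage (· < ·) f := by
      funext a b
      exact propext (strictRel_measureLE f a b)
    rw [this]
    exact InvImage.wf f wellFounded_lt

theorem lexRel_measureLE {β γ : Type*} [LinearOrder β] [LinearOrder γ] (f : α → β) (g : α → γ) :
    LexRel (MeasureLE f) (MeasureLE g) = MeasureLE fun a => toLex (f a, g a) := by
  funext a b
  refine propext ?_
  simp only [LexRel, strictRel_measureLE, EquivRel, MeasureLE, Prod.Lex.toLex_le_toLex]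
  rw [le_antisymm_iff]

theorem toLex_lt_of_lt {β γ : Type*} [LinearOrder β] [LinearOrder γ] {a b : β} {c d : γ}
    (h : a < b) : toLex (a, c) < toLex (b, d) :=
  Prod.Lex.toLex_lt_toLex.2 (Or.inl h)

theorem toLex_lt_of_le {β γ : Type*} [LinearOrder β] [LinearOrder γ] {a b : β} {c d : γ}
    (h : a ≤ b) (h' : c < d) : toLex (a, c) < toLex (b, d) :=
  Prod.Lex.toLex_lt_toLex.2 (h.lt_or_eq.imp_right fun h => ⟨h, h'⟩)

variable {n m : ℕ}

/-- The number of U-paths. -/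
noncomputable def uCount (G : MAHyp bialg n m) : ℕ∞ := ENat.card (UPath G.1)

/-- The number of M-paths. -/
noncomputable def mCount (G : MAHyp bialg n m) : ℕ∞ := ENat.card (MPath G.1)

/-- The number of `μ`-hyperedges. -/
noncomputable def muCount (G : MAHyp bialg n m) : ℕ := Nat.card G.1.G.Mu

/-- The number of `δ`-hyperedges. -/
noncomputable def deltaCount (G : MAHyp bialg n m) : ℕ := Nat.card G.1.G.Delta

/-- The L-weight. -/
noncomputable def lCount (G : MAHyp bialg n m) : ℕ := LWeight G.1.G

theorem uCount_eq (G : MAHyp bialg n m) : uCount G = Nat.card (UPath G.1) := by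
  have := (exists_weight_u G.2).1
  exact ENat.card_eq_coe_natCard _

theorem mCount_eq (G : MAHyp bialg n m) : mCount G = Nat.card (MPath G.1) := by
  have := (exists_weight_m G.2).1
  exact ENat.card_eq_coe_natCard _

/-- All the quantities compared by the ordering, combined lexicographically. -/
noncomputable def measureBA (G : MAHyp bialg n m) : ℕ∞ ×ₗ ℕ∞ ×ₗ ℕ ×ₗ ℕ ×ₗ ℕ :=
  toLex (uCount G, toLex (mCount G, toLex (muCount G, toLex (deltaCount G, lCount G))))

/-- The ordering is pulled back from a lexicographic product of well-ordered sets, which makes it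
well-founded. -/
theorem leBA_eq (n m : ℕ) : leBA n m = MeasureLE measureBA := by
  change LexRel (MeasureLE uCount) (LexRel (MeasureLE mCount) (LexRel (MeasureLE muCount)
    (LexRel (MeasureLE deltaCount) (MeasureLE lCount)))) = _
  simp only [lexRel_measureLE]
  rfl

theorem isWellFoundedPreorder_component (c : Fin 5) :
    IsWellFoundedPreorder (component n m c) := by
  fin_cases c
  · exact isWellFoundedPreorder_measureLE uCount
  · exact isWellFoundedPreorder_measureLE mCount
  · exact isWellFoundedPreorder_measureLE muCount
  · exact isWellFoundedPreorder_measureLE deltaCount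
  · exact isWellFoundedPreorder_measureLE lCount

end Orderings

/-! ### The deciding component of each rule, and termination -/

section Main

variable {n m : ℕ} {ρ : Rule bialg} {G H : MAHyp bialg n m}

theorem RuleStep.leU (h : RuleStep ρ G.1 H.1) (hρ : ρ ∈ BA) : leU H G := by
  have := h.card_uPath_add_le hρ G.2 H.2 0 (controls_u_of_mem_BA ρ hρ)
  change uCount H ≤ uCount G
  rw [uCount_eq, uCount_eq]
  exact_mod_cast this

theorem strictRel_leU (h : Nat.card (UPath H.1) < Nat.card (UPath G.1)) : StrictRel leU H G := by
  refine (strictRel_measureLE uCount H G).2 ?_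
  rw [uCount_eq, uCount_eq]
  exact_mod_cast h

theorem RuleStep.leM (h : RuleStep ρ G.1 H.1) (hρ : ρ ∈ BA)
    (hk : Weight.m.Controls ρ BialgOp.mu (0 : Fin 1) 0) : leM H G := by
  have := h.card_mPath_add_le hρ G.2 H.2 0 hk
  change mCount H ≤ mCount G
  rw [mCount_eq, mCount_eq]
  exact_mod_cast this

theorem RuleStep.strictRel_leM (h : RuleStep ρ G.1 H.1) (hρ : ρ ∈ BA)
    (hk : Weight.m.Controls ρ BialgOp.mu (0 : Fin 1) 1) : StrictRel ConvexRewriting.leM H G := by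
  have := h.card_mPath_add_le hρ G.2 H.2 1 hk
  refine (strictRel_measureLE mCount H G).2 ?_
  rw [mCount_eq, mCount_eq]
  exact_mod_cast this

theorem RuleStep.leMu (h : RuleStep ρ G.1 H.1)
    {a b : ℕ}
    (hR : Nat.card ρ.rhs.G.Mu = a) (hL : Nat.card ρ.lhs.G.Mu = b) (hab : a ≤ b) : leMu H G := by
  have := h.card_mu
  change Nat.card H.1.G.Mu ≤ Nat.card G.1.G.Mu
  omega

theorem RuleStep.strictRel_leMu (h : RuleStep ρ G.1 H.1)
    {a b : ℕ}
    (hR : Nat.card ρ.rhs.G.Mu = a) (hL : Nat.card ρ.lhs.G.Mu = b) (hab : a < b) :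
    StrictRel ConvexRewriting.leMu H G := by
  have := h.card_mu
  refine (strictRel_measureLE muCount H G).2 ?_
  change Nat.card H.1.G.Mu < Nat.card G.1.G.Mu
  omega

theorem RuleStep.leDelta (h : RuleStep ρ G.1 H.1)
    {a b : ℕ}
    (hR : Nat.card ρ.rhs.G.Delta = a) (hL : Nat.card ρ.lhs.G.Delta = b) (hab : a ≤ b) : leDelta H G := by
  have := h.card_delta
  change Nat.card H.1.G.Delta ≤ Nat.card G.1.G.Delta
  omega

theorem RuleStep.strictRel_leDelta (h : RuleStep ρ G.1 H.1)
    {a b : ℕ}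
    (hR : Nat.card ρ.rhs.G.Delta = a) (hL : Nat.card ρ.lhs.G.Delta = b) (hab : a < b) :
    StrictRel ConvexRewriting.leDelta H G := by
  have := h.card_delta
  refine (strictRel_measureLE deltaCount H G).2 ?_
  change Nat.card H.1.G.Delta < Nat.card G.1.G.Delta
  omega

theorem RuleStep.strictRel_leL (h : RuleStep ρ G.1 H.1) (hρ : ρ ∈ BA) {k l : ℕ}
    (hk : Weight.muChain.Controls ρ BialgOp.mu (0 : Fin 1) k)
    (hl : Weight.deltaTree.Controls ρ BialgOp.delta (0 : Fin 2) l) (hkl : 0 < k + l) :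
    StrictRel leL H G := by
  have := h.lWeight_add_le hρ G.2 H.2 k l hk hl
  refine (strictRel_measureLE lCount H G).2 ?_
  change LWeight H.1.G < LWeight G.1.G
  omega

/-- Along steps by `ρ`, the component `c` of the ordering decreases and the earlier ones do not
increase. -/
def DecreasesAt (ρ : Rule bialg) (c : Fin 5) : Prop :=
  ∀ (n m : ℕ) (G H : MAHyp bialg n m), RuleStep ρ G.1 H.1 →
    StrictRel (component n m c) H G ∧ ∀ b < c, component n m b H G

theorem decreasesAt_zero
    (h : ∀ (n m : ℕ) (G H : MAHyp bialg n m), RuleStep ρ G.1 H.1 → StrictRel leU H G) :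
    DecreasesAt ρ 0 :=
  fun n m G H hs => ⟨h n m G H hs, fun b hb => (Fin.not_lt_zero b hb).elim⟩

theorem decreasesAt_one
    (h : ∀ (n m : ℕ) (G H : MAHyp bialg n m), RuleStep ρ G.1 H.1 → leU H G ∧ StrictRel leM H G) :
    DecreasesAt ρ 1 := by
  intro n m G H hs
  obtain ⟨h0, h1⟩ := h n m G H hs
  refine ⟨h1, fun b hb => ?_⟩
  fin_cases b
  · exact h0
  all_goals exact absurd hb (by decide)

theorem decreasesAt_two
    (h : ∀ (n m : ℕ) (G H : MAHyp bialg n m), RuleStep ρ G.1 H.1 →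
      leU H G ∧ leM H G ∧ StrictRel leMu H G) : DecreasesAt ρ 2 := by
  intro n m G H hs
  obtain ⟨h0, h1, h2⟩ := h n m G H hs
  refine ⟨h2, fun b hb => ?_⟩
  fin_cases b
  · exact h0
  · exact h1
  all_goals exact absurd hb (by decide)

theorem decreasesAt_three
    (h : ∀ (n m : ℕ) (G H : MAHyp bialg n m), RuleStep ρ G.1 H.1 →
      leU H G ∧ leM H G ∧ leMu H G ∧ StrictRel leDelta H G) : DecreasesAt ρ 3 := by
  intro n m G H hs
  obtain ⟨h0, h1, h2, h3⟩ := h n m G H hs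
  refine ⟨h3, fun b hb => ?_⟩
  fin_cases b
  · exact h0
  · exact h1
  · exact h2
  all_goals exact absurd hb (by decide)

theorem decreasesAt_four
    (h : ∀ (n m : ℕ) (G H : MAHyp bialg n m), RuleStep ρ G.1 H.1 →
      leU H G ∧ leM H G ∧ leMu H G ∧ leDelta H G ∧ StrictRel leL H G) : DecreasesAt ρ 4 := by
  intro n m G H hs
  obtain ⟨h0, h1, h2, h3, h4⟩ := h n m G H hs
  refine ⟨h4, fun b hb => ?_⟩
  fin_cases b
  · exact h0
  · exact h1
  · exact h2
  · exact h3
  · exact absurd hb (by decide)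

/-- Component 0 (U-paths) decides rules 3, 4, 5, 6 and 10; component 1 (M-paths) rule 9; component 2
(`μ`) rule 8; component 3 (`δ`) rule 7; component 4 (L-weight) rules 1 and 2. -/
theorem exists_decreasesAt : ∀ ρ ∈ BA, ∃ c, DecreasesAt ρ c := by
  intro ρ hρ
  have hu : ρ ∈ ({BA3, BA4, BA10} : Set (Rule bialg)) → DecreasesAt ρ 0 := fun hρ' =>
    decreasesAt_zero fun n m G H h =>
      strictRel_leU (h.card_uPath_add_le hρ G.2 H.2 1 (controls_u_strict ρ hρ'))
  have hu' : ρ ∈ ({BA5, BA6} : Set (Rule bialg)) → DecreasesAt ρ 0 := fun hρ' =>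
    decreasesAt_zero fun n m G H h =>
      strictRel_leU (h.card_uPath_lt hρ G.2 H.2 (forces_u_lt ρ hρ'))
  rcases id hρ with rfl | rfl | rfl | rfl | rfl | rfl | rfl | rfl | rfl | rfl
  · exact ⟨4, decreasesAt_four fun n m G H h => ⟨h.leU hρ, h.leM hρ (controls_m _ (by simp)),
      h.leMu card_mu_mkHyp card_mu_mkHyp le_rfl,
      h.leDelta card_delta_mkHyp card_delta_mkHyp le_rfl,
      h.strictRel_leL hρ controls_muChain_BA1 controls_deltaTree_BA1 Nat.one_pos⟩⟩
  · exact ⟨4, decreasesAt_four fun n m G H h => ⟨h.leU hρ, h.leM hρ (controls_m _ (by simp)),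
      h.leMu card_mu_mkHyp card_mu_mkHyp le_rfl,
      h.leDelta card_delta_mkHyp card_delta_mkHyp le_rfl,
      h.strictRel_leL hρ controls_muChain_BA2 controls_deltaTree_BA2 Nat.one_pos⟩⟩
  · exact ⟨0, hu (by simp)⟩
  · exact ⟨0, hu (by simp)⟩
  · exact ⟨0, hu' (by simp)⟩
  · exact ⟨0, hu' (by simp)⟩
  · exact ⟨3, decreasesAt_three fun n m G H h => ⟨h.leU hρ, h.leM hρ (controls_m _ (by simp)),
      h.leMu card_mu_mkHyp card_mu_mkHyp le_rfl,
      h.strictRel_leDelta card_delta_mkHyp card_delta_mkHyp Nat.one_pos⟩⟩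
  · exact ⟨2, decreasesAt_two fun n m G H h => ⟨h.leU hρ, h.leM hρ (controls_m _ (by simp)),
      h.strictRel_leMu card_mu_mkHyp card_mu_mkHyp Nat.one_pos⟩⟩
  · exact ⟨1, decreasesAt_one fun n m G H h => ⟨h.leU hρ, h.strictRel_leM hρ controls_m_BA9⟩⟩
  · exact ⟨0, hu (by simp)⟩

theorem DecreasesAt.measureBA_lt {c : Fin 5} (hc : DecreasesAt ρ c)
    (h : RuleStep ρ G.1 H.1) : measureBA H < measureBA G := by
  obtain ⟨hs, hw⟩ := hc n m G H h
  have h0 : 0 < c → uCount H ≤ uCount G := hw 0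
  have h1 : 1 < c → mCount H ≤ mCount G := hw 1
  have h2 : 2 < c → muCount H ≤ muCount G := hw 2
  have h3 : 3 < c → deltaCount H ≤ deltaCount G := hw 3
  unfold measureBA
  fin_cases c
  · exact toLex_lt_of_lt ((strictRel_measureLE uCount H G).1 hs)
  · exact toLex_lt_of_le (h0 (by decide)) (toLex_lt_of_lt ((strictRel_measureLE mCount H G).1 hs))
  · exact toLex_lt_of_le (h0 (by decide)) (toLex_lt_of_le (h1 (by decide))
      (toLex_lt_of_lt ((strictRel_measureLE muCount H G).1 hs)))
  · exact toLex_lt_of_le (h0 (by decide)) (toLex_lt_of_le (h1 (by decide))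
      (toLex_lt_of_le (h2 (by decide))
        (toLex_lt_of_lt ((strictRel_measureLE deltaCount H G).1 hs))))
  · exact toLex_lt_of_le (h0 (by decide)) (toLex_lt_of_le (h1 (by decide))
      (toLex_lt_of_le (h2 (by decide))
        (toLex_lt_of_le (h3 (by decide)) ((strictRel_measureLE lCount H G).1 hs))))

theorem Step.strictRel_leBA (h : Step BA G.1 H.1) : StrictRel (leBA n m) H G := by
  obtain ⟨ρ, hρ, h⟩ := h
  obtain ⟨c, hc⟩ := exists_decreasesAt ρ hρ
  rw [leBA_eq]
  exact (strictRel_measureLE _ H G).2 (hc.measureBA_lt h)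

theorem isReductionOrdering_leBA (n m : ℕ) : IsReductionOrdering BA (leBA n m) where
  toIsWellFoundedPreorder := by
    rw [leBA_eq]
    exact isWellFoundedPreorder_measureLE _
  decreases _ _ h := h.strictRel_leBA

/-- Only the first diagram is assumed monogamous acyclic. Preservation along steps places the whole
sequence in the domain of the well-founded ordering, where a minimal term would have a smaller
successor. -/
theorem terminating_BA : Terminating BA := by
  rintro n m ⟨s, h0, hs⟩
  have hMA : ∀ k, (s k).MonogamousAcyclic := by
    intro k
    induction k with
    | zero => exact h0
    | succ k ih =>
      obtain ⟨ρ, hρ, h⟩ := hs k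
      exact h.monogamousAcyclic (rhs_monogamousAcyclic_of_mem_BA ρ hρ) ih
  have hwf := (isReductionOrdering_leBA n m).wf
  let t : ℕ → MAHyp bialg n m := fun k => ⟨s k, hMA k⟩
  obtain ⟨k, hk⟩ := hwf.has_min (Set.range t) ⟨_, 0, rfl⟩
  obtain ⟨⟨l, rfl⟩, hl⟩ := hk
  exact hl (t (l + 1)) ⟨l + 1, rfl⟩ (Step.strictRel_leBA (hs l))

end Main

end ConvexRewriting

theorem mainTheorem6 :
    (∀ n m : ℕ, ConvexRewriting.IsReductionOrdering ConvexRewriting.BA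
      (ConvexRewriting.leBA n m)) ∧
    (∀ ρ ∈ ConvexRewriting.BA, ∃ c : Fin 5, ∀ n m : ℕ,
      ConvexRewriting.IsReductionOrdering {ρ} (ConvexRewriting.component n m c) ∧
      ∀ b < c, ConvexRewriting.IsWeakReductionOrdering {ρ} (ConvexRewriting.component n m b)) ∧
    ConvexRewriting.Terminating ConvexRewriting.BA := by
  refine ⟨ConvexRewriting.isReductionOrdering_leBA, fun ρ hρ => ?_,
    ConvexRewriting.terminating_BA⟩
  obtain ⟨c, hc⟩ := ConvexRewriting.exists_decreasesAt ρ hρ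
  refine ⟨c, fun n m => ⟨⟨ConvexRewriting.isWellFoundedPreorder_component c, ?_⟩, fun b hb =>
    ⟨ConvexRewriting.isWellFoundedPreorder_component b, ?_⟩⟩⟩
  · rintro G H ⟨_, rfl, h⟩
    exact (hc n m G H h).1
  · rintro G H ⟨_, rfl, h⟩
    exact (hc n m G H h).2 b hb
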